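/- For $x,z,a\in\mathbb C\setminus\{0\}$ and $|p|<1$ let $$\theta(x;p)=\prod_{j\ge 0}(1-p^jx)(1-p^{j+1}/x),\qquad (x;q,p)_n=\prod_{k=0}^{n-1}\theta(xq^k;p),\qquad (x_1,x_2;q,p)_n=(x_1;q,p)_n(x_2;q,p)_n,$$ $$\gamma(z,a;p)=\sum_{k=-\infty}^{\infty}\sum_{l=-\infty}^{\infty}p^{k^2+kl+l^2}a^{k+l}z^{k-l},$$ $$\big\langle\big\langle az,a/z;q,p^{1/3}\big\rangle\big\rangle_n=\prod_{j=0}^{n-1}\gamma\big(aq^{\frac{n-1}{2}},zq^{\frac{1-n}{2}+j};p^{1/3}\big).$$ The last product depends only on $az$, $a/z$, $q$, $p^{1/3}$ and $n$, since $\gamma(-z,-a;p)=\gamma(z,a;p)$. Let $n\ge 0$ be an integer and let $a,c,z,q,p$ be complex numbers with $a,c,z,q\neq 0$ and $|p|<1$. Fix any fourth root $q^{1/4}$ of $q$ (with $q^{m/4}=(q^{1/4})^m$ for integers $m$) and any cube root $p^{1/3}$ of $p$. Suppose that no denominator below vanishes, i.e. that $(cz,c/z;q,p)_n\ne0$, $(q;q,p)_n\neq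 0$, $(cq^{n-\frac14};q^{\frac12},p)_n\neq0$ and $\theta(cq^{\frac k2-\frac34};p)\ne0$ for $0\le k\le n$. Then $$\frac{\big\langle\big\langle az, a/z;q,p^{\frac 13}\big\rangle\big\rangle_n}{(cz, c/z;q,p)_n} \big(cq^{-\frac{1}{4}}, cq^{\frac{1}{4}};q,p\big)_n =\sum_{k=0}^n c^k q^{\frac{k}{4}(k-2)+nk} \frac{\theta\big(cq^{\frac{3}{2}k-\frac{3}{4}};p\big)} {\theta\big(cq^{\frac{k}{2}-\frac{3}{4}};p\big)}\frac{\big(q^{-n};q,p\big)_k}{(q;q,p)_k} \frac{\big(c q^{-\frac{1}{4}};q^{\frac{1}{2}},p\big)_k} {\big(cq^{n-\frac{1}{4}};q^{\frac{1}{2}},p\big)_k} \frac{\big(q^{\frac{1}{4}}z, q^{\frac{1}{4}}/z;q^{\frac{1}{2}},p\big)_k} {(cz, c/z;q,p)_k}$$ $$\qquad\times \big\langle\big\langle ac q^{n-1},aq^{1-k}/c;q,p^{\frac 13}\big\rangle\big\rangle_k\; \big\langle\big\langle aq^{\frac{k}{2}+\frac{1}{4}},aq^{\frac{k}{2}-\frac{1}{4}};q,p^{\frac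 13}\big\rangle\big\rangle_{n-k}.$$ -/

import Mathlib

noncomputable section

/-- The modified Jacobi theta function
`θ(x;p) = ∏_{j ≥ 0} (1 - p^j x) (1 - p^(j+1) / x)`, for `x ≠ 0`, `|p| < 1`. -/
def modTheta (x p : ℂ) : ℂ :=
  ∏' j : ℕ, ((1 - p ^ j * x) * (1 - p ^ (j + 1) / x))

/-- The theta shifted factorial `(x;q,p)_n = ∏_{k=0}^{n-1} θ(x q^k;p)`, for `n ≥ 0`. -/
def thetaFactorial (x q p : ℂ) (n : ℕ) : ℂ :=
  ∏ k ∈ Finset.range n, modTheta (x * q ^ k) p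

/-- The cubic theta function
`γ(z,a;p) = ∑_{k,l ∈ ℤ} p^(k² + k l + l²) a^(k+l) z^(k-l)`, for `z, a ≠ 0`, `|p| < 1`
(an absolutely convergent double series). -/
def cubicTheta (z a p : ℂ) : ℂ :=
  ∑' kl : ℤ × ℤ,
    p ^ (kl.1 ^ 2 + kl.1 * kl.2 + kl.2 ^ 2) * a ^ (kl.1 + kl.2) * z ^ (kl.1 - kl.2)

/-- The second cubic theta shifted factorial
`⟨⟨a z, a / z; q, r⟩⟩_n = ∏_{j=0}^{n-1} γ(a q^((n-1)/2), z q^((1-n)/2 + j); r)`,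
where `s` is a square root of `q` (so `q = s ^ 2`) and `r` is a cube root of the nome `p`.
Since `γ(-z,-a;p) = γ(z,a;p)`, the value is unchanged under `s ↦ -s` and under
`(a,z) ↦ (-a,-z)`, so it depends only on `a z`, `a / z`, `q`, `r` and `n`. -/
def cubicFactorial (a z s r : ℂ) (n : ℕ) : ℂ :=
  ∏ j ∈ Finset.range n,
    cubicTheta (a * s ^ ((n : ℤ) - 1)) (z * s ^ (1 - (n : ℤ)) * (s ^ 2) ^ j) r

end

noncomputable section

open Filter Topology

/-! Write `q = t ^ 4` and fix `f x = cubicTheta (a * q ^ ((n - 1) / 2)) x r`. All three cubic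
factorials in the identity are products of values of this one `f`, so the cubic structure enters
only through the plane of functions containing `f`. Substituting `k = j + e`, `l = j - e`
diagonalizes `k² + kl + l²` to `3j² + e²`. With the other parity class, this puts `f` in the plane
spanned by `evenTheta p (x ^ 2)` and `x * oddTheta p (x ^ 2)` (`cubicTheta_eq`). By the Jacobi
triple product, `θ(bx) θ(b/x)` is, up to a factor, the determinant of the values of this basis at
`x` and `b` (`eulerProd_sq_mul_modTheta_mul`). Cramer's rule in the plane then expresses `f w`
through `f x` and `f y` with theta products as coefficients (`IsThetaTwo.three_term`).

For generic `c` the expansion is proved by induction on `n`. Splitting off one node of the product,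
the quotient at `(n + 1, c, z)` equals the quotient at `(n, c t², z t⁻²)` times `f (z t^(2n)) / (θ(c
z qⁿ) θ(c/z))`. The three-term relation splits the `k`-th term, times this factor, into a piece that
extends the central product and a piece that extends the progression from `c`
(`expansionTerm_mul_div`). At level `n + 1` these feed indices `k` and `k + 1`. The two pieces
meeting at one index add up to the required term by the Weierstrass addition formula, itself the
three-term relation for a theta product (`expansionTerm_succ`).

Multiplying by `(c q^(-1/4), c q^(1/4); q, p)_n` cancels the denominators that required generic `c`.
Both sides are then continuous in `c` and agree on a dense set of parameters. -/

/-! ### Convergence of theta-type series -/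

/-- The triangular number `k (k - 1) / 2`. -/
def tri (k : ℤ) : ℤ := k * (k - 1) / 2

lemma two_mul_tri (k : ℤ) : 2 * tri k = k * (k - 1) :=
  Int.mul_ediv_cancel' (Int.even_mul_pred_self k).two_dvd

lemma tri_nonneg (k : ℤ) : 0 ≤ tri k := by
  have h := two_mul_tri k
  rcases le_or_gt k 0 with hk | hk <;> nlinarith

lemma tri_succ (k : ℤ) : tri (k + 1) = tri k + k := by
  have h := two_mul_tri k
  have h' := two_mul_tri (k + 1)
  linarith

/-- Replaces `zpow_add₀` where the base may vanish: the nome `p = 0` is allowed throughout. -/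
lemma zpow_add_of_nonneg {G : Type*} [GroupWithZero G] (p : G) {a b : ℤ} (ha : 0 ≤ a)
    (hb : 0 ≤ b) : p ^ (a + b) = p ^ a * p ^ b := by
  lift a to ℕ using ha
  lift b to ℕ using hb
  rw [← Nat.cast_add]
  simp only [zpow_natCast, pow_add]

lemma summable_nat_pow_tri {ρ R : ℝ} (hρ : 0 < ρ) (hρ' : ρ < 1) (hR : 0 < R) :
    Summable fun k : ℕ => ρ ^ tri k * R ^ (k : ℤ) := by
  refine summable_of_ratio_test_tendsto_lt_one (l := 0) one_pos
    (Eventually.of_forall fun k => by positivity) ?_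
  have h : ∀ k : ℕ, ‖ρ ^ tri (k + 1 : ℕ) * R ^ ((k + 1 : ℕ) : ℤ)‖ / ‖ρ ^ tri k * R ^ (k : ℤ)‖
      = ρ ^ k * R := by
    intro k
    rw [← norm_div, Real.norm_of_nonneg (by positivity), Nat.cast_succ, tri_succ,
      zpow_add₀ hρ.ne', zpow_add₀ hR.ne', zpow_natCast, zpow_one]
    field_simp
  simp_rw [h]
  simpa using (tendsto_pow_atTop_nhds_zero_of_lt_one hρ.le hρ').mul_const R

lemma summable_pow_tri {ρ R : ℝ} (hρ : 0 < ρ) (hρ' : ρ < 1) (hR : 0 < R) :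
    Summable fun k : ℤ => ρ ^ tri k * R ^ k := by
  refine Summable.of_nat_of_neg (summable_nat_pow_tri hρ hρ' hR) ?_
  refine (summable_nat_pow_tri hρ hρ' (div_pos hρ hR)).congr fun k => ?_
  have h : tri (-k) = tri k + k := by
    have h := two_mul_tri k
    have h' := two_mul_tri (-k)
    linarith
  rw [h, zpow_add₀ hρ.ne', div_zpow, zpow_neg]
  field_simp

/-- A bilateral sequence that decays faster than every geometric sequence. -/
def RapidDecay (u : ℤ → ℂ) : Prop :=
  ∀ R : ℝ, 0 < R → Summable fun k => ‖u k‖ * R ^ k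

lemma norm_zpow_le_of_nonneg {p : ℂ} {e : ℤ} (he : 0 ≤ e) :
    ‖p ^ e‖ ≤ (max ‖p‖ (1 / 2)) ^ e := by
  lift e to ℕ using he
  rw [zpow_natCast, zpow_natCast, norm_pow]
  gcongr
  exact le_max_left _ _

lemma rapidDecay_of_tri {p : ℂ} (hp : ‖p‖ < 1) {u : ℤ → ℂ} (e : ℤ → ℤ) (he : ∀ k, 0 ≤ e k)
    (hu : ∀ k, ‖u k‖ = ‖p ^ e k‖) (m : ℕ) (hm : m ≠ 0) (l : ℤ)
    (hel : ∀ k, e k = m * tri k + l * k) : RapidDecay u := by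
  intro R hR
  -- The maximum with `1 / 2` keeps the comparison base positive when `p = 0`.
  set ρ := max ‖p‖ (1 / 2)
  have hρ : 0 < ρ := lt_max_of_lt_right (by norm_num)
  have hρ' : ρ < 1 := max_lt hp (by norm_num)
  refine Summable.of_nonneg_of_le (fun k => by positivity) (fun k => ?_)
    (summable_pow_tri (pow_pos hρ m) (pow_lt_one₀ hρ.le hρ' hm)
      (R := ρ ^ l * R) (by positivity))
  rw [hu, mul_zpow, ← zpow_mul, ← mul_assoc, ← zpow_natCast, ← zpow_mul, ← zpow_add₀ hρ.ne',
    ← hel]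
  exact mul_le_mul_of_nonneg_right (norm_zpow_le_of_nonneg (he k)) (by positivity)

lemma RapidDecay.summable_norm {u : ℤ → ℂ} (hu : RapidDecay u) {x : ℂ} (hx : x ≠ 0) :
    Summable fun k => ‖u k * x ^ k‖ := by
  simpa [norm_mul, norm_zpow] using hu ‖x‖ (norm_pos_iff.2 hx)

/-- Weierstrass M-test on the annulus `‖x‖ / 2 < ‖y‖ < 2 ‖x‖`: there `‖y‖ ^ k` is at most the sum of
its two boundary values, whatever the sign of `k`. -/
lemma RapidDecay.continuousAt {u : ℤ → ℂ} (hu : RapidDecay u) {x : ℂ} (hx : x ≠ 0) :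
    ContinuousAt (fun y => ∑' k, u k * y ^ k) x := by
  have hx' := norm_pos_iff.2 hx
  have h1 : 0 < ‖x‖ / 2 := by positivity
  have h2 : 0 < 2 * ‖x‖ := by positivity
  let s : Set ℂ := {y | ‖x‖ / 2 < ‖y‖ ∧ ‖y‖ < 2 * ‖x‖}
  have hs : IsOpen s :=
    (isOpen_lt continuous_const continuous_norm).inter (isOpen_lt continuous_norm continuous_const)
  have hmem : x ∈ s := ⟨by linarith, by linarith⟩
  have hs0 : ∀ y ∈ s, y ≠ 0 := fun y hy => norm_pos_iff.1 (h1.trans hy.1)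
  refine (continuousOn_tsum (u := fun k => ‖u k‖ * (‖x‖ / 2) ^ k + ‖u k‖ * (2 * ‖x‖) ^ k)
    (fun k => ?_) ((hu _ h1).add (hu _ h2)) fun k y hy => ?_).continuousAt (hs.mem_nhds hmem)
  · exact continuousOn_const.mul (continuousOn_id.zpow₀ k fun y hy => Or.inl (hs0 y hy))
  · rw [norm_mul, norm_zpow, ← mul_add]
    refine mul_le_mul_of_nonneg_left ?_ (norm_nonneg _)
    have hy0 : 0 < ‖y‖ := h1.trans hy.1
    rcases le_total 0 k with hk | hk
    · have := zpow_le_zpow_left₀ hk hy0.le hy.2.le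
      have : 0 < (‖x‖ / 2) ^ k := by positivity
      linarith
    · have : ‖y‖ ^ k ≤ (‖x‖ / 2) ^ k := by
        obtain ⟨m, rfl⟩ := Int.exists_eq_neg_ofNat hk
        simp only [zpow_neg, zpow_natCast]
        have := hy.1.le
        gcongr
      have : 0 < (2 * ‖x‖) ^ k := by positivity
      linarith

/-! ### The finite `p`-binomial theorem and the Jacobi triple product -/

/-- The Gaussian binomial coefficient, with integer lower entry. -/
def gaussBinom (p : ℂ) : ℕ → ℤ → ℂ
  | 0, k => if k = 0 then 1 else 0
  | N + 1, k => p ^ k * gaussBinom p N k + gaussBinom p N (k - 1)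

lemma gaussBinom_of_neg (p : ℂ) (N : ℕ) {k : ℤ} (hk : k < 0) : gaussBinom p N k = 0 := by
  induction N generalizing k with
  | zero => simp [gaussBinom, hk.ne]
  | succ N ih => rw [gaussBinom, ih hk, ih (by omega)]; simp

lemma gaussBinom_of_lt (p : ℂ) (N : ℕ) {k : ℤ} (hk : N < k) : gaussBinom p N k = 0 := by
  induction N generalizing k with
  | zero => simp [gaussBinom, (show k ≠ 0 by simpa using hk.ne')]
  | succ N ih => push_cast at hk; rw [gaussBinom, ih (by omega), ih (by omega)]; simp

lemma gaussBinom_zero_right (p : ℂ) (N : ℕ) : gaussBinom p N 0 = 1 := by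
  induction N with
  | zero => simp [gaussBinom]
  | succ N ih => rw [gaussBinom, ih, gaussBinom_of_neg p N (by norm_num)]; simp

lemma gaussBinom_self (p : ℂ) (N : ℕ) : gaussBinom p N N = 1 := by
  induction N with
  | zero => simp [gaussBinom]
  | succ N ih =>
    rw [gaussBinom, gaussBinom_of_lt p N (by simp)]
    simp [ih]

/-- The finite product `(p;p)_n`. -/
def eulerPoch (p : ℂ) (n : ℕ) : ℂ := ∏ j ∈ Finset.range n, (1 - p ^ (j + 1))

lemma gaussBinom_mul (p : ℂ) (a b : ℕ) :
    gaussBinom p (a + b) a * (eulerPoch p a * eulerPoch p b) = eulerPoch p (a + b) := by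
  induction hN : a + b generalizing a b with
  | zero =>
    obtain ⟨rfl, rfl⟩ : a = 0 ∧ b = 0 := by omega
    simp [gaussBinom, eulerPoch]
  | succ N ih =>
    rcases a with _ | a
    · obtain rfl : b = N + 1 := by omega
      rw [Nat.cast_zero, gaussBinom_zero_right]; simp [eulerPoch]
    rcases b with _ | b
    · obtain rfl : a = N := by omega
      rw [gaussBinom_self]; simp [eulerPoch]
    have h1 := ih (a + 1) b (by omega)
    have h2 := ih a (b + 1) (by omega)
    have hs : ∀ m, eulerPoch p (m + 1) = eulerPoch p m * (1 - p ^ (m + 1)) :=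
      fun m => Finset.prod_range_succ _ _
    have hp : p ^ (N + 1) = p ^ (a + 1) * p ^ (b + 1) := by rw [← pow_add]; congr 1; omega
    rw [gaussBinom, hs N, hp, show ((a + 1 : ℕ) : ℤ) - 1 = a by push_cast; ring, zpow_natCast]
    rw [hs] at h1 h2 ⊢
    rw [hs b]
    linear_combination p ^ (a + 1) * (1 - p ^ (b + 1)) * h1 + (1 - p ^ (a + 1)) * h2

/-- The `p`-binomial theorem: splitting off the factor `1 - x` leaves the product for `p * x`, and
the recursion defining `gaussBinom` matches the coefficients. -/
lemma hasSum_prod_one_sub (p x : ℂ) (m : ℕ) :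
    HasSum (fun k : ℤ => (-1) ^ k * p ^ tri k * gaussBinom p m k * x ^ k)
      (∏ j ∈ Finset.range m, (1 - p ^ j * x)) := by
  induction m generalizing x with
  | zero =>
    simp only [Finset.range_zero, Finset.prod_empty]
    convert hasSum_ite_eq (0 : ℤ) (1 : ℂ) using 2 with k
    by_cases hk : k = 0 <;> simp [gaussBinom, hk, tri]
  | succ m ih =>
    have h := ih (p * x)
    have h' := ((Equiv.subRight (1 : ℤ)).hasSum_iff.2 h).mul_left (-x)
    rw [Finset.prod_range_succ']
    convert h.add h' using 1
    · ext k
      have h1 : (-1 : ℂ) ^ (k - 1) = - (-1) ^ k := by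
        rw [zpow_sub_one₀ (by norm_num)]; norm_num
      have h2 : gaussBinom p m (k - 1) * p ^ tri k * x ^ k
          = gaussBinom p m (k - 1) * (p ^ tri (k - 1) * p ^ (k - 1)) * (x ^ (k - 1) * x) := by
        rcases lt_or_ge (k - 1) 0 with hk | hk
        · simp [gaussBinom_of_neg p m hk]
        · rw [← zpow_add_of_nonneg p (tri_nonneg _) hk, ← tri_succ]
          have := zpow_add_of_nonneg x hk zero_le_one
          rw [zpow_one, sub_add_cancel] at this
          rw [← this, sub_add_cancel]
      simp only [Function.comp_apply, Equiv.subRight_apply, gaussBinom, h1, mul_zpow]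
      linear_combination (-1) ^ k * h2
    · have : ∀ j, 1 - p ^ (j + 1) * x = 1 - p ^ j * (p * x) := fun j => by ring
      simp only [this]
      ring

/-- Finite form of the triple product; multiplying by `1 - p ^ (n + 1) / x` is again one step of the
recursion for `gaussBinom`. -/
lemma hasSum_prod_mul_prod (p : ℂ) {x : ℂ} (hx : x ≠ 0) (m n : ℕ) :
    HasSum (fun k : ℤ => (-1) ^ k * p ^ tri k * gaussBinom p (m + n) (n + k) * x ^ k)
      ((∏ j ∈ Finset.range m, (1 - p ^ j * x)) * ∏ j ∈ Finset.range n, (1 - p ^ (j + 1) / x)) := by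
  induction n with
  | zero => simpa using hasSum_prod_one_sub p x m
  | succ n ih =>
    have h' := ((Equiv.addRight (1 : ℤ)).hasSum_iff.2 ih).mul_left (-(p ^ (n + 1) / x))
    rw [Finset.prod_range_succ]
    convert ih.add h' using 1
    · ext k
      have h1 : (-1 : ℂ) ^ (k + 1) = - (-1) ^ k := by
        rw [zpow_add_one₀ (by norm_num)]; norm_num
      have h2 : gaussBinom p (m + n) (n + k + 1) * (p ^ (n + k + 1 : ℤ) * p ^ tri k)
          = gaussBinom p (m + n) (n + k + 1) * (p ^ (n + 1) * p ^ tri (k + 1)) := by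
        rcases lt_or_ge (n + k + 1 : ℤ) 0 with hk | hk
        · simp [gaussBinom_of_neg p _ hk]
        · rw [← zpow_add_of_nonneg p hk (tri_nonneg _), ← zpow_natCast p (n + 1),
            ← zpow_add_of_nonneg p (by positivity) (tri_nonneg _), tri_succ]
          congr 2
          push_cast; ring
      have e1 : ((n + 1 : ℕ) : ℤ) + k = n + k + 1 := by push_cast; ring
      simp only [Function.comp_apply, Equiv.coe_addRight, ← add_assoc, gaussBinom, h1, e1,
        zpow_add_one₀ hx, add_sub_cancel_right]
      field_simp
      linear_combination h2
    · ring

lemma summable_norm_pow_succ {p : ℂ} (hp : ‖p‖ < 1) : Summable fun j : ℕ => ‖-p ^ (j + 1)‖ := by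
  simp only [norm_neg, norm_pow]
  exact (summable_geometric_of_lt_one (norm_nonneg p) hp).comp_injective (add_left_injective 1)

/-- The infinite product `(p;p)_∞`. -/
def eulerProd (p : ℂ) : ℂ := ∏' j : ℕ, (1 - p ^ (j + 1))

lemma one_sub_pow_succ_ne_zero {p : ℂ} (hp : ‖p‖ < 1) (j : ℕ) : 1 - p ^ (j + 1) ≠ 0 := by
  intro h
  have : ‖p ^ (j + 1)‖ = 1 := by rw [← sub_eq_zero.1 h, norm_one]
  rw [norm_pow] at this
  exact (pow_lt_one₀ (norm_nonneg p) hp (Nat.succ_ne_zero j)).ne this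

lemma eulerPoch_ne_zero {p : ℂ} (hp : ‖p‖ < 1) (n : ℕ) : eulerPoch p n ≠ 0 :=
  Finset.prod_ne_zero_iff.2 fun j _ => one_sub_pow_succ_ne_zero hp j

lemma eulerProd_ne_zero {p : ℂ} (hp : ‖p‖ < 1) : eulerProd p ≠ 0 := by
  have := tprod_one_add_ne_zero_of_summable (f := fun j : ℕ => -p ^ (j + 1))
    (fun j => by simpa [sub_eq_add_neg] using one_sub_pow_succ_ne_zero hp j)
    (summable_norm_pow_succ hp)
  simpa [eulerProd, sub_eq_add_neg] using this

lemma tendsto_eulerPoch {p : ℂ} (hp : ‖p‖ < 1) :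
    Tendsto (eulerPoch p) atTop (𝓝 (eulerProd p)) := by
  have := (multipliable_one_add_of_summable (summable_norm_pow_succ hp)).hasProd.tendsto_prod_nat
  simp only [← sub_eq_add_neg] at this
  exact this

/-- Both `(p;p)_n` and its inverse converge, hence are bounded. The uniform bound is the domination
needed to let the finite triple product tend to the infinite one. -/
lemma exists_norm_gaussBinom_le {p : ℂ} (hp : ‖p‖ < 1) :
    ∃ C : ℝ, ∀ N k, ‖gaussBinom p N k‖ ≤ C := by
  obtain ⟨A, hA⟩ := (tendsto_eulerPoch hp).norm.bddAbove_range
  obtain ⟨B, hB⟩ := ((tendsto_eulerPoch hp).inv₀ (eulerProd_ne_zero hp)).norm.bddAbove_range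
  replace hA : ∀ n, ‖eulerPoch p n‖ ≤ A := fun n => hA ⟨n, rfl⟩
  replace hB : ∀ n, ‖(eulerPoch p n)⁻¹‖ ≤ B := fun n => hB ⟨n, rfl⟩
  have hA0 : 0 ≤ A := (norm_nonneg _).trans (hA 0)
  have hB0 : 0 ≤ B := (norm_nonneg _).trans (hB 0)
  refine ⟨A * (B * B), fun N k => ?_⟩
  rcases lt_or_ge k 0 with hk | hk
  · rw [gaussBinom_of_neg p N hk, norm_zero]; positivity
  lift k to ℕ using hk
  rcases lt_or_ge N k with hk | hk
  · rw [gaussBinom_of_lt p N (by exact_mod_cast hk), norm_zero]; positivity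
  obtain ⟨b, rfl⟩ := Nat.exists_eq_add_of_le hk
  have h := gaussBinom_mul p k b
  have h0 := eulerPoch_ne_zero hp k
  have h1 := eulerPoch_ne_zero hp b
  have : gaussBinom p (k + b) k = eulerPoch p (k + b) * ((eulerPoch p k)⁻¹ * (eulerPoch p b)⁻¹) := by
    rw [← h]; field_simp
  rw [this, norm_mul, norm_mul]
  gcongr
  exacts [hA _, hB _, hB _]

lemma tendsto_gaussBinom {p : ℂ} (hp : ‖p‖ < 1) (k : ℤ) :
    Tendsto (fun n : ℕ => gaussBinom p (n + n) (n + k)) atTop (𝓝 (eulerProd p)⁻¹) := by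
  have hE := eulerProd_ne_zero hp
  have key : ∀ᶠ n : ℕ in atTop, eulerPoch p (n + n) *
      ((eulerPoch p (n + k).toNat)⁻¹ * (eulerPoch p (n - k).toNat)⁻¹)
        = gaussBinom p (n + n) (n + k) := by
    filter_upwards [eventually_ge_atTop k.natAbs] with n hn
    have h := gaussBinom_mul p (n + k).toNat (n - k).toNat
    rw [show (n + k : ℤ).toNat + (n - k : ℤ).toNat = n + n by omega,
      Int.toNat_of_nonneg (by omega)] at h
    have h0 := eulerPoch_ne_zero hp (n + k).toNat
    have h1 := eulerPoch_ne_zero hp (n - k).toNat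
    rw [← h]; field_simp
  refine Tendsto.congr' key ?_
  have t0 : Tendsto (fun n : ℕ => n + n) atTop atTop :=
    tendsto_atTop_mono (fun n => Nat.le_add_left n n) tendsto_id
  have t1 : ∀ l : ℤ, Tendsto (fun n : ℕ => (n + l : ℤ).toNat) atTop atTop := fun l =>
    tendsto_atTop.2 fun b => by
      filter_upwards [eventually_ge_atTop (b + l.natAbs)] with n hn
      omega
  have e := tendsto_eulerPoch hp
  have := (e.comp t0).mul (((e.comp (t1 k)).inv₀ hE).mul ((e.comp (t1 (-k))).inv₀ hE))
  simpa [hE, Function.comp_def, sub_eq_add_neg] using this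

lemma rapidDecay_theta {p : ℂ} (hp : ‖p‖ < 1) :
    RapidDecay fun k : ℤ => (-1) ^ k * p ^ tri k :=
  rapidDecay_of_tri hp tri tri_nonneg (fun k => by simp) 1 one_ne_zero 0 fun k => by simp

lemma summable_norm_thetaFactor {p : ℂ} (hp : ‖p‖ < 1) (x : ℂ) :
    Summable fun j : ℕ => ‖(1 - p ^ j * x) * (1 - p ^ (j + 1) / x) - 1‖ := by
  have h := summable_geometric_of_lt_one (norm_nonneg p) hp
  refine Summable.of_nonneg_of_le (fun _ => norm_nonneg _) (fun j => ?_)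
    (h.mul_right (‖x‖ + ‖p / x‖ + ‖p‖))
  have e : (1 - p ^ j * x) * (1 - p ^ (j + 1) / x) - 1
      = p ^ j * (-x + -(p / x) + p ^ (j + 1) * (x / x)) := by ring
  rw [e, norm_mul, norm_pow]
  gcongr
  refine (norm_add₃_le).trans ?_
  rw [norm_neg, norm_neg]
  gcongr
  rw [norm_mul, norm_pow]
  have h1 : ‖x / x‖ ≤ 1 := by
    rcases eq_or_ne x 0 with rfl | hx <;> simp [*]
  have h2 : ‖p‖ ^ (j + 1) ≤ ‖p‖ := pow_le_of_le_one (norm_nonneg p) hp.le (Nat.succ_ne_zero j)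
  nlinarith [norm_nonneg p, norm_nonneg (x / x), pow_nonneg (norm_nonneg p) (j + 1)]

lemma tendsto_prod_modTheta {p : ℂ} (hp : ‖p‖ < 1) (x : ℂ) :
    Tendsto (fun n : ℕ => (∏ j ∈ Finset.range n, (1 - p ^ j * x)) *
      ∏ j ∈ Finset.range n, (1 - p ^ (j + 1) / x)) atTop (𝓝 (modTheta x p)) := by
  have := (multipliable_one_add_of_summable
    (summable_norm_thetaFactor hp x)).hasProd.tendsto_prod_nat
  simpa [modTheta, ← Finset.prod_mul_distrib] using this

/-- Jacobi's triple product identity. -/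
theorem eulerProd_mul_modTheta {p : ℂ} (hp : ‖p‖ < 1) {x : ℂ} (hx : x ≠ 0) :
    eulerProd p * modTheta x p = ∑' k : ℤ, (-1) ^ k * p ^ tri k * x ^ k := by
  obtain ⟨C, hC⟩ := exists_norm_gaussBinom_le hp
  have h : Tendsto (fun n : ℕ => ∑' k : ℤ, (-1) ^ k * p ^ tri k * gaussBinom p (n + n) (n + k)
      * x ^ k) atTop (𝓝 (∑' k : ℤ, (-1) ^ k * p ^ tri k * (eulerProd p)⁻¹ * x ^ k)) := by
    refine tendsto_tsum_of_dominated_convergence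
      (((rapidDecay_theta hp).summable_norm hx).mul_left C) (fun k => ?_)
      (Eventually.of_forall fun n k => ?_)
    · exact ((tendsto_gaussBinom hp k).const_mul _).mul_const _
    · rw [mul_right_comm, norm_mul, mul_comm]
      gcongr
      exact hC _ _
  have h' := tendsto_nhds_unique ((tendsto_prod_modTheta hp x).congr fun n =>
    (hasSum_prod_mul_prod p hx n n).tsum_eq.symm) h
  rw [h', ← tsum_mul_left]
  refine tsum_congr fun k => ?_
  have := eulerProd_ne_zero hp
  field_simp

/-! ### Splitting double series by parity -/

lemma hasSum_of_eq {ι : Type*} {f g : ι → ℂ} {a : ℂ} (h : ∀ i, f i = g i) (hg : HasSum g a) :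
    HasSum f a := by
  rwa [funext h]

/-- The images of the two parametrizations are the pairs whose sum of entries is even, respectively
odd. -/
lemma hasSum_of_parity {f : ℤ × ℤ → ℂ} {a b : ℂ}
    (h0 : HasSum (fun i : ℤ × ℤ => f (i.1 + i.2, i.1 - i.2)) a)
    (h1 : HasSum (fun i : ℤ × ℤ => f (i.1 + i.2 + 1, i.1 - i.2)) b) : HasSum f (a + b) := by
  have i0 : Function.Injective fun i : ℤ × ℤ => (i.1 + i.2, i.1 - i.2) := by
    rintro ⟨a, b⟩ ⟨c, d⟩ h
    simp only [Prod.mk.injEq] at h ⊢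
    omega
  have i1 : Function.Injective fun i : ℤ × ℤ => (i.1 + i.2 + 1, i.1 - i.2) := by
    rintro ⟨a, b⟩ ⟨c, d⟩ h
    simp only [Prod.mk.injEq] at h ⊢
    omega
  refine HasSum.add_isCompl (s := Set.range fun i : ℤ × ℤ => (i.1 + i.2, i.1 - i.2))
    (t := Set.range fun i : ℤ × ℤ => (i.1 + i.2 + 1, i.1 - i.2)) ⟨?_, ?_⟩
    (i0.hasSum_range_iff.2 h0) (i1.hasSum_range_iff.2 h1)
  · rw [Set.disjoint_iff]
    rintro _ ⟨⟨⟨a, b⟩, rfl⟩, ⟨⟨c, d⟩, h⟩⟩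
    simp only [Prod.mk.injEq] at h
    omega
  · rw [codisjoint_iff_le_sup]
    rintro ⟨k, l⟩ -
    rcases Int.even_or_odd' (k + l) with ⟨m, hm | hm⟩
    · exact Or.inl ⟨(m, m - l), by simp only [Prod.mk.injEq]; omega⟩
    · exact Or.inr ⟨(m, m - l), by simp only [Prod.mk.injEq]; omega⟩

/-- The theta series `∑ p ^ (k ^ 2) x ^ k`. -/
def evenTheta (p x : ℂ) : ℂ := ∑' k : ℤ, p ^ (k ^ 2) * x ^ k

/-- The theta series `∑ p ^ (k ^ 2 + k) x ^ k`. -/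
def oddTheta (p x : ℂ) : ℂ := ∑' k : ℤ, p ^ (k ^ 2 + k) * x ^ k

lemma sq_add_self_nonneg (k : ℤ) : 0 ≤ k ^ 2 + k := by
  have := tri_nonneg (k + 1)
  have := two_mul_tri (k + 1)
  linarith

lemma rapidDecay_even {p : ℂ} (hp : ‖p‖ < 1) : RapidDecay fun k : ℤ => p ^ (k ^ 2) :=
  rapidDecay_of_tri hp (fun k => k ^ 2) (fun k => sq_nonneg k) (fun _ => rfl) 2 two_ne_zero 1
    fun k => by push_cast; linarith [two_mul_tri k]

lemma rapidDecay_odd {p : ℂ} (hp : ‖p‖ < 1) : RapidDecay fun k : ℤ => p ^ (k ^ 2 + k) :=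
  rapidDecay_of_tri hp (fun k => k ^ 2 + k) sq_add_self_nonneg (fun _ => rfl) 2 two_ne_zero 2
    fun k => by push_cast; linarith [two_mul_tri k]

lemma hasSum_mul_of_rapidDecay {u v : ℤ → ℂ} (hu : RapidDecay u) (hv : RapidDecay v) {x y : ℂ}
    (hx : x ≠ 0) (hy : y ≠ 0) : HasSum (fun i : ℤ × ℤ => u i.1 * x ^ i.1 * (v i.2 * y ^ i.2))
      ((∑' k, u k * x ^ k) * ∑' k, v k * y ^ k) := by
  rw [tsum_mul_tsum_of_summable_norm (hu.summable_norm hx) (hv.summable_norm hy)]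
  exact (summable_mul_of_summable_norm (hu.summable_norm hx) (hv.summable_norm hy)).hasSum

/-- On the even class `(j + e, j - e)` the quadratic form is `3j² + e²`, on the odd class `(j + e +
1, j - e)` it is `3(j² + j) + (e² + e) + 1`. Each class therefore factors into a series in `a` of
nome `r ^ 3 = p` and a series in `z` of nome `r`. -/
lemma cubicTheta_eq {r p : ℂ} (hr : r ^ 3 = p) (hp : ‖p‖ < 1) {z a : ℂ} (hz : z ≠ 0)
    (ha : a ≠ 0) : cubicTheta z a r = evenTheta r (z ^ 2) * evenTheta p (a ^ 2)
      + r * (z * oddTheta r (z ^ 2)) * (a * oddTheta p (a ^ 2)) := by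
  have hr' : ‖r‖ < 1 := by
    rw [← hr, norm_pow] at hp
    exact (pow_lt_one_iff_of_nonneg (norm_nonneg r) three_ne_zero).1 hp
  rw [mul_comm (evenTheta r _), show r * (z * oddTheta r (z ^ 2)) * (a * oddTheta p (a ^ 2))
    = r * z * a * (oddTheta p (a ^ 2) * oddTheta r (z ^ 2)) by ring]
  refine (hasSum_of_parity ?_ ?_).tsum_eq
  · refine hasSum_of_eq (fun i => ?_) (hasSum_mul_of_rapidDecay (rapidDecay_even hp)
      (rapidDecay_even hr') (pow_ne_zero 2 ha) (pow_ne_zero 2 hz))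
    · obtain ⟨j, e⟩ := i
      have h : r ^ ((j + e) ^ 2 + (j + e) * (j - e) + (j - e) ^ 2) = p ^ (j ^ 2) * r ^ (e ^ 2) := by
        rw [← hr, ← zpow_natCast r 3, ← zpow_mul, ← zpow_add_of_nonneg _ (by positivity)
          (by positivity)]
        congr 1; push_cast; ring
      have h1 : a ^ (j + e + (j - e)) = (a ^ 2) ^ j := by
        rw [← zpow_natCast a 2, ← zpow_mul]; congr 1; push_cast; ring
      have h2 : z ^ (j + e - (j - e)) = (z ^ 2) ^ e := by
        rw [← zpow_natCast z 2, ← zpow_mul]; congr 1; push_cast; ring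
      simp only [h, h1, h2]
      ring
  · refine hasSum_of_eq (fun i => ?_) ((hasSum_mul_of_rapidDecay (rapidDecay_odd hp)
      (rapidDecay_odd hr') (pow_ne_zero 2 ha) (pow_ne_zero 2 hz)).mul_left (r * z * a))
    · obtain ⟨j, e⟩ := i
      have h : r ^ ((j + e + 1) ^ 2 + (j + e + 1) * (j - e) + (j - e) ^ 2)
          = p ^ (j ^ 2 + j) * r ^ (e ^ 2 + e) * r := by
        have hj := sq_add_self_nonneg j
        have he := sq_add_self_nonneg e
        nth_rw 3 [← zpow_one r]
        rw [← hr, ← zpow_natCast r 3, ← zpow_mul,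
          ← zpow_add_of_nonneg _ (by positivity) he, ← zpow_add_of_nonneg _ (by positivity)
            zero_le_one]
        congr 1; push_cast; ring
      have h1 : a ^ (j + e + 1 + (j - e)) = (a ^ 2) ^ j * a := by
        rw [← zpow_natCast a 2, ← zpow_mul, ← zpow_add_one₀ ha]; congr 1; push_cast; ring
      have h2 : z ^ (j + e + 1 - (j - e)) = (z ^ 2) ^ e * z := by
        rw [← zpow_natCast z 2, ← zpow_mul, ← zpow_add_one₀ hz]; congr 1; push_cast; ring
      simp only [h, h1, h2]
      ring

lemma evenTheta_inv (p x : ℂ) : evenTheta p x⁻¹ = evenTheta p x := by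
  rw [evenTheta, ← (Equiv.neg ℤ).tsum_eq]
  simp [evenTheta]

lemma oddTheta_inv (p : ℂ) {x : ℂ} (hx : x ≠ 0) : oddTheta p x⁻¹ = x * oddTheta p x := by
  rw [oddTheta, ← (Equiv.subLeft (-1 : ℤ)).tsum_eq, oddTheta, ← tsum_mul_left]
  refine tsum_congr fun k => ?_
  rw [Equiv.subLeft_apply, inv_zpow', show -(-1 - k) = k + 1 by ring, zpow_add_one₀ hx,
    show (-1 - k) ^ 2 + (-1 - k) = k ^ 2 + k by ring]
  ring

lemma modTheta_inv {p : ℂ} (hp : ‖p‖ < 1) {x : ℂ} (hx : x ≠ 0) :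
    modTheta x⁻¹ p = -x⁻¹ * modTheta x p := by
  have h : eulerProd p * modTheta x⁻¹ p = -x⁻¹ * (eulerProd p * modTheta x p) := by
    rw [eulerProd_mul_modTheta hp hx, eulerProd_mul_modTheta hp (inv_ne_zero hx),
      ← (Equiv.subLeft (1 : ℤ)).tsum_eq, ← tsum_mul_left]
    refine tsum_congr fun k => ?_
    have h1 : tri (1 - k) = tri k := by
      have := two_mul_tri (1 - k)
      have := two_mul_tri k
      linarith
    have h2 : (-1 : ℂ) ^ (1 - k) = -(-1) ^ k := by
      rw [zpow_sub₀ (by norm_num), zpow_one]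
      rcases Int.even_or_odd k with hk | hk
      · simp [hk.neg_one_zpow]
      · simp [hk.neg_one_zpow]
    rw [Equiv.subLeft_apply, inv_zpow', h1, h2, show -(1 - k) = k + -1 by ring, zpow_add₀ hx,
      zpow_neg_one]
    ring
  refine mul_left_cancel₀ (eulerProd_ne_zero hp) ?_
  rw [h]; ring

lemma modTheta_one (p : ℂ) : modTheta 1 p = 0 :=
  tprod_of_exists_eq_zero ⟨0, by simp⟩

lemma mul_zpow_mul_div_zpow {c z : ℂ} (hc : c ≠ 0) (hz : z ≠ 0) (m n : ℤ) :
    (c * z) ^ m * (c / z) ^ n = c ^ (m + n) * z ^ (m - n) := by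
  rw [mul_zpow, div_zpow, zpow_add₀ hc, zpow_sub₀ hz]
  ring

/-- Multiply two triple product series and split by parity of the sum of the indices. The right side
is `c` times a 2×2 determinant in the values of the even and odd basis functions at `z` and `c`. -/
lemma eulerProd_sq_mul_modTheta_mul {p : ℂ} (hp : ‖p‖ < 1) {c z : ℂ} (hc : c ≠ 0) (hz : z ≠ 0) :
    eulerProd p ^ 2 * (modTheta (c * z) p * modTheta (c / z) p)
      = c * (evenTheta p (z ^ 2) * (c * oddTheta p (c ^ 2))
          - z * oddTheta p (z ^ 2) * evenTheta p (c ^ 2)) := by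
  have hcz := mul_ne_zero hc hz
  have hcz' := div_ne_zero hc hz
  have key := hasSum_mul_of_rapidDecay (rapidDecay_theta hp) (rapidDecay_theta hp) hcz hcz'
  rw [← eulerProd_mul_modTheta hp hcz, ← eulerProd_mul_modTheta hp hcz'] at key
  -- Reindexed to match the even class, where `tri (j + e) + tri (j - e) = (j² - j) + e²`.
  have hO : oddTheta p (c ^ 2) = (c ^ 2)⁻¹ * ∑' k : ℤ, p ^ (k ^ 2 - k) * (c ^ 2) ^ k := by
    rw [← (Equiv.addRight (1 : ℤ)).tsum_eq, ← tsum_mul_left, oddTheta]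
    refine tsum_congr fun k => ?_
    rw [Equiv.coe_addRight, zpow_add_one₀ (pow_ne_zero 2 hc),
      show (k + 1) ^ 2 - (k + 1) = k ^ 2 + k by ring]
    field_simp
  have hR : RapidDecay fun k : ℤ => p ^ (k ^ 2 - k) :=
    rapidDecay_of_tri hp (fun k => k ^ 2 - k) (fun k => by linarith [two_mul_tri k, tri_nonneg k])
      (fun _ => rfl) 2 two_ne_zero 0 fun k => by push_cast; linarith [two_mul_tri k]
  have key' := hasSum_of_parity
    (f := fun i : ℤ × ℤ => (-1) ^ i.1 * p ^ tri i.1 * (c * z) ^ i.1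
      * ((-1) ^ i.2 * p ^ tri i.2 * (c / z) ^ i.2))
    (a := (∑' k : ℤ, p ^ (k ^ 2 - k) * (c ^ 2) ^ k) * evenTheta p (z ^ 2))
    (b := -(c * z) * (evenTheta p (c ^ 2) * oddTheta p (z ^ 2))) ?_ ?_
  · have := key.unique key'
    rw [hO]
    field_simp
    linear_combination this
  · refine hasSum_of_eq (fun i => ?_) (hasSum_mul_of_rapidDecay hR (rapidDecay_even hp)
      (pow_ne_zero 2 hc) (pow_ne_zero 2 hz))
    obtain ⟨j, e⟩ := i
    have h : p ^ (j ^ 2 - j) * p ^ (e ^ 2) = p ^ tri (j + e) * p ^ tri (j - e) := by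
      rw [← zpow_add_of_nonneg _ (tri_nonneg _) (tri_nonneg _), ← zpow_add_of_nonneg _
        (by linarith [two_mul_tri j, tri_nonneg j]) (sq_nonneg e)]
      congr 1; linarith [two_mul_tri (j + e), two_mul_tri (j - e)]
    have h1 : (-1 : ℂ) ^ (j + e) * (-1) ^ (j - e) = 1 := by
      rw [← zpow_add₀ (by norm_num)]
      exact Even.neg_one_zpow ⟨j, by ring⟩
    have h2 : (c * z) ^ (j + e) * (c / z) ^ (j - e) = (c ^ 2) ^ j * (z ^ 2) ^ e := by
      rw [mul_zpow_mul_div_zpow hc hz, ← zpow_natCast c 2, ← zpow_mul, ← zpow_natCast z 2,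
        ← zpow_mul]
      congr 2 <;> push_cast <;> ring
    linear_combination (p ^ tri (j + e) * p ^ tri (j - e) * ((c * z) ^ (j + e) * (c / z) ^ (j - e)))
      * h1 + p ^ tri (j + e) * p ^ tri (j - e) * h2 - (c ^ 2) ^ j * (z ^ 2) ^ e * h
  · refine hasSum_of_eq (fun i => ?_) ((hasSum_mul_of_rapidDecay (rapidDecay_even hp)
      (rapidDecay_odd hp) (pow_ne_zero 2 hc) (pow_ne_zero 2 hz)).mul_left (-(c * z)))
    obtain ⟨j, e⟩ := i
    have h : p ^ (j ^ 2) * p ^ (e ^ 2 + e) = p ^ tri (j + e + 1) * p ^ tri (j - e) := by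
      rw [← zpow_add_of_nonneg _ (tri_nonneg _) (tri_nonneg _), ← zpow_add_of_nonneg _
        (sq_nonneg j) (sq_add_self_nonneg e)]
      congr 1; linarith [two_mul_tri (j + e + 1), two_mul_tri (j - e)]
    have h1 : (-1 : ℂ) ^ (j + e + 1) * (-1) ^ (j - e) = -1 := by
      rw [← zpow_add₀ (by norm_num)]
      exact Odd.neg_one_zpow ⟨j, by ring⟩
    have h2 : (c * z) ^ (j + e + 1) * (c / z) ^ (j - e)
        = c * z * ((c ^ 2) ^ j * (z ^ 2) ^ e) := by
      rw [mul_zpow_mul_div_zpow hc hz, show j + e + 1 + (j - e) = (2 : ℕ) * j + 1 by push_cast; ring,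
        show j + e + 1 - (j - e) = (2 : ℕ) * e + 1 by push_cast; ring, zpow_add_one₀ hc,
        zpow_add_one₀ hz, zpow_mul, zpow_mul, zpow_natCast, zpow_natCast]
      ring
    linear_combination (p ^ tri (j + e + 1) * p ^ tri (j - e)
      * ((c * z) ^ (j + e + 1) * (c / z) ^ (j - e))) * h1
      - p ^ tri (j + e + 1) * p ^ tri (j - e) * h2 + c * z * (c ^ 2) ^ j * (z ^ 2) ^ e * h

/-! ### The plane of symmetric theta functions of degree two -/

/-- Symmetric theta functions of degree two and nome `p`, written in the basis given by the even
and odd parts of `∑ p ^ (k ^ 2 / 4) x ^ k`. -/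
def IsThetaTwo (p : ℂ) (f : ℂ → ℂ) : Prop :=
  ∃ u v : ℂ, ∀ x, x ≠ 0 → f x = u * evenTheta p (x ^ 2) + v * (x * oddTheta p (x ^ 2))

lemma isThetaTwo_cubicTheta {r p : ℂ} (hr : r ^ 3 = p) (hp : ‖p‖ < 1) {z : ℂ} (hz : z ≠ 0) :
    IsThetaTwo p fun a => cubicTheta z a r :=
  ⟨_, _, fun _ ha => cubicTheta_eq hr hp hz ha⟩

lemma isThetaTwo_modTheta {p : ℂ} (hp : ‖p‖ < 1) {b : ℂ} (hb : b ≠ 0) :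
    IsThetaTwo p fun x => modTheta (b * x) p * modTheta (b / x) p := by
  have hP := eulerProd_ne_zero hp
  refine ⟨b * (b * oddTheta p (b ^ 2)) / eulerProd p ^ 2,
    -b * evenTheta p (b ^ 2) / eulerProd p ^ 2, fun x hx => ?_⟩
  have h := eulerProd_sq_mul_modTheta_mul hp hb hx
  field_simp
  linear_combination h

namespace IsThetaTwo

variable {p : ℂ} {f : ℂ → ℂ}

lemma inv (hf : IsThetaTwo p f) {x : ℂ} (hx : x ≠ 0) : f x⁻¹ = f x := by
  obtain ⟨u, v, h⟩ := hf
  rw [h _ hx, h _ (inv_ne_zero hx), inv_pow, evenTheta_inv, oddTheta_inv p (pow_ne_zero 2 hx)]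
  field_simp

lemma continuousAt (hf : IsThetaTwo p f) (hp : ‖p‖ < 1) {x : ℂ} (hx : x ≠ 0) :
    ContinuousAt f x := by
  obtain ⟨u, v, h⟩ := hf
  have hsq : ContinuousAt (fun y : ℂ => y ^ 2) x := by fun_prop
  have h0 : ContinuousAt (fun y => evenTheta p (y ^ 2)) x :=
    ContinuousAt.comp (f := fun y : ℂ => y ^ 2) (g := evenTheta p)
      ((rapidDecay_even hp).continuousAt (pow_ne_zero 2 hx)) hsq
  have h1 : ContinuousAt (fun y => oddTheta p (y ^ 2)) x :=
    ContinuousAt.comp (f := fun y : ℂ => y ^ 2) (g := oddTheta p)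
      ((rapidDecay_odd hp).continuousAt (pow_ne_zero 2 hx)) hsq
  refine ContinuousAt.congr (f := fun y => u * evenTheta p (y ^ 2) + v * (y * oddTheta p (y ^ 2)))
    (by fun_prop) ?_
  filter_upwards [isOpen_ne.mem_nhds hx] with y hy using (h y hy).symm

/-- The three-term relation for symmetric theta functions of degree two. -/
lemma three_term (hf : IsThetaTwo p f) (hp : ‖p‖ < 1) {w x y : ℂ} (hw : w ≠ 0) (hx : x ≠ 0)
    (hy : y ≠ 0) : f w * (x * (modTheta (x * y) p * modTheta (y / x) p))
      = f x * (x * (modTheta (y * w) p * modTheta (y / w) p))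
        - f y * (y * (modTheta (x * w) p * modTheta (x / w) p)) := by
  obtain ⟨u, v, h⟩ := hf
  refine mul_left_cancel₀ (pow_ne_zero 2 (eulerProd_ne_zero hp)) ?_
  have e1 := eulerProd_sq_mul_modTheta_mul hp hy hx
  have e2 := eulerProd_sq_mul_modTheta_mul hp hy hw
  have e3 := eulerProd_sq_mul_modTheta_mul hp hx hw
  rw [mul_comm y x] at e1
  -- With `[x, y]` the determinant of the basis values at `x` and `y`, this is `f w [x, y] = f x [w,
  -- y] - f y [w, x]`, valid for every `f` in the plane.
  linear_combination f w * x * e1 - f x * x * e2 + f y * y * e3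
    + x * y * (evenTheta p (x ^ 2) * (y * oddTheta p (y ^ 2))
          - x * oddTheta p (x ^ 2) * evenTheta p (y ^ 2)) * h w hw
    - x * y * (evenTheta p (w ^ 2) * (y * oddTheta p (y ^ 2))
          - w * oddTheta p (w ^ 2) * evenTheta p (y ^ 2)) * h x hx
    + y * x * (evenTheta p (w ^ 2) * (x * oddTheta p (x ^ 2))
          - w * oddTheta p (w ^ 2) * evenTheta p (x ^ 2)) * h y hy

end IsThetaTwo

/-! ### Continuity and zeros of the modified theta function -/

lemma continuousAt_modTheta {p : ℂ} (hp : ‖p‖ < 1) {x : ℂ} (hx : x ≠ 0) :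
    ContinuousAt (fun y => modTheta y p) x := by
  refine ContinuousAt.congr
    (((rapidDecay_theta hp).continuousAt hx).const_mul (eulerProd p)⁻¹) ?_
  filter_upwards [isOpen_ne.mem_nhds hx] with y hy
  rw [← eulerProd_mul_modTheta hp hy, inv_mul_cancel_left₀ (eulerProd_ne_zero hp)]

lemma exists_of_modTheta_eq_zero {p : ℂ} (hp : ‖p‖ < 1) {x : ℂ} (h : modTheta x p = 0) :
    ∃ j : ℕ, p ^ j * x = 1 ∨ p ^ (j + 1) / x = 1 := by
  by_contra! hne
  refine tprod_one_add_ne_zero_of_summable (fun j => ?_) (summable_norm_thetaFactor hp x)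
    (by simpa [modTheta] using h)
  rw [add_sub_cancel]
  exact mul_ne_zero (sub_ne_zero.2 (hne j).1.symm) (sub_ne_zero.2 (hne j).2.symm)

/-- Every zero of `modTheta` is a `p ^ (-j)` or a `p ^ (j + 1)`. Countability makes the generic
parameters `c` dense. -/
lemma countable_modTheta_eq_zero {p : ℂ} (hp : ‖p‖ < 1) {t : ℂ} (ht : t ≠ 0) :
    {c : ℂ | ∃ m : ℤ, modTheta (c * t ^ m) p = 0}.Countable := by
  refine Set.Countable.mono (s₂ := ⋃ i : ℤ × ℕ, {(p ^ i.2)⁻¹ / t ^ i.1, p ^ (i.2 + 1) / t ^ i.1})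
    ?_ (Set.countable_iUnion fun i => (Set.toFinite _).countable)
  rintro c ⟨m, hm⟩
  obtain ⟨j, hj | hj⟩ := exists_of_modTheta_eq_zero hp hm
  · refine Set.mem_iUnion.2 ⟨(m, j), Or.inl ?_⟩
    rw [eq_div_iff (zpow_ne_zero m ht)]
    exact eq_inv_of_mul_eq_one_right hj
  · refine Set.mem_iUnion.2 ⟨(m, j), Or.inr ?_⟩
    rw [Set.mem_singleton_iff, eq_div_iff (zpow_ne_zero m ht)]
    exact ((div_eq_one_iff_eq fun h0 => by simp [h0] at hj).1 hj).symm

/-! ### Theta shifted factorials and elliptic binomial coefficients -/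

section ThetaFactorial

variable (x q p : ℂ)

lemma thetaFactorial_zero : thetaFactorial x q p 0 = 1 := by simp [thetaFactorial]

lemma thetaFactorial_succ (n : ℕ) :
    thetaFactorial x q p (n + 1) = thetaFactorial x q p n * modTheta (x * q ^ n) p :=
  Finset.prod_range_succ _ _

lemma thetaFactorial_add (m n : ℕ) : thetaFactorial x q p (m + n)
    = thetaFactorial x q p m * thetaFactorial (x * q ^ m) q p n := by
  simp only [thetaFactorial, Finset.prod_range_add, pow_add, mul_assoc]

lemma thetaFactorial_succ' (n : ℕ) :
    thetaFactorial x q p (n + 1) = modTheta x p * thetaFactorial (x * q) q p n := by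
  rw [add_comm, thetaFactorial_add, thetaFactorial_succ, thetaFactorial_zero]
  simp

variable {x q p}

lemma thetaFactorial_ne_zero_of_le {m n : ℕ} (hmn : m ≤ n) (h : thetaFactorial x q p n ≠ 0) :
    thetaFactorial x q p m ≠ 0 := by
  obtain ⟨k, rfl⟩ := Nat.exists_eq_add_of_le hmn
  rw [thetaFactorial_add] at h
  exact left_ne_zero_of_mul h

lemma modTheta_ne_zero_of_lt {m n : ℕ} (hmn : m < n) (h : thetaFactorial x q p n ≠ 0) :
    modTheta (x * q ^ m) p ≠ 0 := by
  have := thetaFactorial_ne_zero_of_le hmn h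
  rw [thetaFactorial_succ] at this
  exact right_ne_zero_of_mul this

end ThetaFactorial

/-- The elliptic binomial coefficient. -/
def thetaBinom (q p : ℂ) (n k : ℕ) : ℂ :=
  thetaFactorial q q p n / (thetaFactorial q q p k * thetaFactorial q q p (n - k))

lemma thetaBinom_succ_mul {q p : ℂ} {n k : ℕ} (hk : k ≤ n)
    (h : thetaFactorial q q p (n + 1) ≠ 0) :
    thetaBinom q p (n + 1) k * modTheta (q ^ (n + 1 - k)) p
      = thetaBinom q p n k * modTheta (q ^ (n + 1)) p := by
  obtain ⟨d, rfl⟩ := Nat.exists_eq_add_of_le hk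
  rw [thetaBinom, thetaBinom, show k + d + 1 - k = d + 1 by omega, Nat.add_sub_cancel_left]
  have h1 := thetaFactorial_ne_zero_of_le (show k ≤ k + d + 1 by omega) h
  have h2 := thetaFactorial_ne_zero_of_le (show d + 1 ≤ k + d + 1 by omega) h
  rw [thetaFactorial_succ, ← pow_succ'] at h2 ⊢
  rw [thetaFactorial_succ _ _ _ d, ← pow_succ']
  have h3 := left_ne_zero_of_mul h2
  have h4 := right_ne_zero_of_mul h2
  field_simp

lemma thetaBinom_succ_succ_mul {q p : ℂ} {n k : ℕ} (hk : k ≤ n)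
    (h : thetaFactorial q q p (n + 1) ≠ 0) :
    thetaBinom q p (n + 1) (k + 1) * modTheta (q ^ (k + 1)) p
      = thetaBinom q p n k * modTheta (q ^ (n + 1)) p := by
  rw [thetaBinom, thetaBinom, Nat.add_sub_add_right]
  have h1 := thetaFactorial_ne_zero_of_le (show n - k ≤ n + 1 by omega) h
  have h2 := thetaFactorial_ne_zero_of_le (show k + 1 ≤ n + 1 by omega) h
  rw [thetaFactorial_succ _ _ _ k, ← pow_succ'] at h2 ⊢
  rw [thetaFactorial_succ _ _ _ n, ← pow_succ']
  have h3 := left_ne_zero_of_mul h2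
  have h4 := right_ne_zero_of_mul h2
  field_simp

/-! ### The Weierstrass addition formula -/

/-- A four-factor instance of the Weierstrass addition formula. -/
lemma modTheta_quadratic_addition {p : ℂ} (hp : ‖p‖ < 1) {c z t : ℂ} (hc : c ≠ 0) (hz : z ≠ 0)
    (ht : t ≠ 0) (N K : ℤ) :
    t ^ (4 * K) * modTheta (t ^ (4 * (N + 1 - K))) p * modTheta (c * t ^ (2 * K - 3)) p
        * modTheta (z * t ^ (-1 - 2 * K)) p * modTheta (c * z * t ^ (4 * N + 4 * K)) p
      + modTheta (t ^ (4 * K)) p * modTheta (c * t ^ (4 * N + 2 * K + 1)) p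
        * modTheta (z * t ^ (4 * N - 2 * K + 3)) p * modTheta (c * z * t ^ (4 * K - 4)) p
      = modTheta (t ^ (4 * (N + 1))) p * modTheta (c * t ^ (6 * K - 3)) p
        * modTheta (z * t ^ (2 * K - 1)) p * modTheta (c * z * t ^ (4 * N)) p := by
  -- A square root of `c t` makes every product of two nodes `s t ^ a`, `s t ^ b` of the form `c t ^
  -- d`, and every quotient a pure power of `t`.
  obtain ⟨s, hs⟩ := IsAlgClosed.exists_pow_nat_eq (c * t) two_pos
  have hs0 : s ≠ 0 := by
    rintro rfl
    exact mul_ne_zero hc ht (by simpa using hs.symm)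
  have m1 : ∀ {a b d : ℤ}, a + b + 1 = d → s * t ^ a * (s * t ^ b) = c * t ^ d := by
    rintro a b d rfl
    rw [zpow_add_one₀ ht, zpow_add₀ ht]
    linear_combination t ^ a * t ^ b * hs
  have m2 : ∀ {a b d : ℤ}, a + b + 1 = d → s * z * t ^ a * (s * t ^ b) = c * z * t ^ d := by
    rintro a b d h
    linear_combination z * m1 h
  have d1 : ∀ {a b d : ℤ}, a - b = d → s * t ^ a / (s * t ^ b) = t ^ d := by
    rintro a b d rfl
    rw [zpow_sub₀ ht]
    field_simp
  have d2 : ∀ {a b d : ℤ}, a - b = d → s * z * t ^ a / (s * t ^ b) = z * t ^ d := by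
    rintro a b d rfl
    rw [zpow_sub₀ ht]
    field_simp
  have i1 : ∀ {m n : ℤ}, m = -n → modTheta (t ^ m) p = -t ^ m * modTheta (t ^ n) p := by
    rintro m n rfl
    rw [zpow_neg, modTheta_inv hp (zpow_ne_zero _ ht)]
  have hn : ∀ m : ℤ, s * t ^ m ≠ 0 := fun m => mul_ne_zero hs0 (zpow_ne_zero _ ht)
  -- The function `x ↦ θ(bx) θ(b/x)` itself lies in the plane, so its three-term relation is the
  -- addition formula.
  have key := (isThetaTwo_modTheta hp (b := s * z * t ^ (2 * N + K - 1))
    (mul_ne_zero (mul_ne_zero hs0 hz) (zpow_ne_zero _ ht))).three_term hp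
    (hn (2 * N - K)) (hn (2 * N + 3 * K)) (hn (3 * K - 4 - 2 * N))
  rw [m2 (d := 4 * N) (by ring), d2 (d := 2 * K - 1) (by ring), m1 (d := 6 * K - 3) (by ring),
    d1 (d := -4 - 4 * N) (by ring), m2 (d := 4 * N + 4 * K) (by ring), d2 (d := -1 - 2 * K) (by ring),
    m1 (d := 2 * K - 3) (by ring), d1 (d := 4 * K - 4 - 4 * N) (by ring),
    m2 (d := 4 * K - 4) (by ring), d2 (d := 4 * N - 2 * K + 3) (by ring),
    m1 (d := 4 * N + 2 * K + 1) (by ring), d1 (d := 4 * K) (by ring),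
    i1 (m := -4 - 4 * N) (n := 4 * (N + 1)) (by ring),
    i1 (m := 4 * K - 4 - 4 * N) (n := 4 * (N + 1 - K)) (by ring)] at key
  have e1 : t ^ (3 * K - 4 - 2 * N) = t ^ (2 * N + 3 * K) * t ^ (-4 - 4 * N) := by
    rw [← zpow_add₀ ht]; congr 1; ring
  have e2 : t ^ (4 * K - 4 - 4 * N) = t ^ (4 * K) * t ^ (-4 - 4 * N) := by
    rw [← zpow_add₀ ht]; congr 1; ring
  rw [e1, e2] at key
  refine mul_left_cancel₀ (mul_ne_zero (hn (2 * N + 3 * K)) (zpow_ne_zero (-4 - 4 * N) ht)) ?_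
  linear_combination key

/-! ### The expansion for generic `c` -/

/-- The product of `f` over the `q`-progression of length `n` centred at `z`, with `q = t ^ 4`. -/
def centredProd (f : ℂ → ℂ) (t : ℂ) (n : ℕ) (z : ℂ) : ℂ :=
  ∏ j ∈ Finset.range n, f (z * t ^ (2 * (1 - (n : ℤ)) + 4 * j))

/-- The product of `f` over the `q`-progression of length `k` starting at `y`, with `q = t ^ 4`. -/
def progProd (f : ℂ → ℂ) (t : ℂ) (k : ℕ) (y : ℂ) : ℂ :=
  ∏ j ∈ Finset.range k, f (y * t ^ (4 * (j : ℤ)))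

lemma progProd_succ (f : ℂ → ℂ) (t : ℂ) (k : ℕ) (y : ℂ) :
    progProd f t (k + 1) y = progProd f t k y * f (y * t ^ (4 * (k : ℤ))) :=
  Finset.prod_range_succ _ _

lemma centredProd_succ (f : ℂ → ℂ) {t : ℂ} (ht : t ≠ 0) (n : ℕ) (z : ℂ) :
    centredProd f t (n + 1) z = centredProd f t n (z * t ^ (-2 : ℤ)) * f (z * t ^ (2 * (n : ℤ))) := by
  rw [centredProd, Finset.prod_range_succ, centredProd]
  congr 1
  · refine Finset.prod_congr rfl fun j _ => ?_
    rw [mul_assoc, ← zpow_add₀ ht]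
    congr 3; push_cast; ring
  · congr 3; push_cast; ring

/-- The product at the central nodes `q ^ (1 / 4)` can be extended on the right after
reflecting it. -/
lemma centredProd_self_succ {p : ℂ} {f : ℂ → ℂ} (hf : IsThetaTwo p f) {t : ℂ} (ht : t ≠ 0) (d : ℕ) :
    centredProd f t (d + 1) t = centredProd f t d t * f (t ^ (1 + 2 * (d : ℤ))) := by
  -- Apart from the last node, the exponents of `t` are `1 - 2d, 5 - 2d, …, 2d - 3`. Negated and
  -- reversed, they are those of the length-`d` progression centred at `t`.
  rw [centredProd, Finset.prod_range_succ, centredProd, ← Finset.prod_range_reflect]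
  congr 1
  · refine Finset.prod_congr rfl fun j hj => ?_
    have hj := Finset.mem_range.1 hj
    rw [← hf.inv (mul_ne_zero ht (zpow_ne_zero _ ht)), ← zpow_one_add₀ ht, ← zpow_one_add₀ ht,
      ← zpow_neg]
    congr 2; push_cast [Nat.cast_sub (show j ≤ d - 1 by omega), Nat.cast_sub (show 1 ≤ d by omega)]
    ring
  · rw [← zpow_one_add₀ ht]; congr 2; push_cast; ring

/-- The `k`-th term of the expansion of `centredProd f t n z / (c z, c / z; q, p)_n`. -/
def expansionTerm (f : ℂ → ℂ) (p t : ℂ) (n : ℕ) (c z : ℂ) (k : ℕ) : ℂ :=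
  (-c) ^ k * t ^ (3 * (k : ℤ) ^ 2 - 4 * k) * thetaBinom (t ^ 4) p n k
    * modTheta (c * t ^ (6 * (k : ℤ) - 3)) p
    / thetaFactorial (c * t ^ (2 * (k : ℤ) - 3)) (t ^ 2) p (2 * n + 1)
    * (thetaFactorial (t * z) (t ^ 2) p k * thetaFactorial (t / z) (t ^ 2) p k)
    / (thetaFactorial (c * z) (t ^ 4) p k * thetaFactorial (c / z) (t ^ 4) p k)
    * progProd f t k (c * t ^ (2 * ((n : ℤ) - 1))) * centredProd f t (n - k) t

/-- The part of the `k`-th term at level `n + 1` that comes from the `k`-th term at level `n`. -/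
def leftPart (f : ℂ → ℂ) (p t : ℂ) (n : ℕ) (c z : ℂ) (k : ℕ) : ℂ :=
  (-c) ^ k * t ^ (3 * (k : ℤ) ^ 2 - 2 * k)
    * (thetaBinom (t ^ 4) p (n + 1) k * modTheta ((t ^ 4) ^ (n + 1 - k)) p
      / modTheta ((t ^ 4) ^ (n + 1)) p)
    / thetaFactorial (c * t ^ (2 * (k : ℤ) - 1)) (t ^ 2) p (2 * n + 2)
    * (thetaFactorial (z / t) (t ^ 2) p k * thetaFactorial (t ^ 3 / z) (t ^ 2) p k)
    * modTheta (c * z * t ^ (4 * (n : ℤ) + 4 * k)) p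
    / (thetaFactorial (c * z) (t ^ 4) p k * thetaFactorial (c / z) (t ^ 4) p k
      * modTheta (c * z * t ^ (4 * (n : ℤ))) p)
    * progProd f t k (c * t ^ (2 * (n : ℤ))) * centredProd f t (n + 1 - k) t

/-- The part of the `k + 1`-st term at level `n + 1` that comes from the `k`-th term at level
`n`. -/
def rightPart (f : ℂ → ℂ) (p t : ℂ) (n : ℕ) (c z : ℂ) (k : ℕ) : ℂ :=
  (-c) ^ (k + 1) * t ^ (3 * (k : ℤ) ^ 2 + 2 * k) * -z⁻¹ * thetaBinom (t ^ 4) p n k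
    / thetaFactorial (c * t ^ (2 * (k : ℤ) - 1)) (t ^ 2) p (2 * n + 2)
    * (thetaFactorial (z / t) (t ^ 2) p (k + 1) * thetaFactorial (t ^ 3 / z) (t ^ 2) p k)
    * modTheta (z * t ^ (4 * (n : ℤ) - 2 * k + 1)) p * modTheta (c * z * t ^ (4 * (k : ℤ))) p
    / (thetaFactorial (c * z) (t ^ 4) p (k + 1) * thetaFactorial (c / z) (t ^ 4) p (k + 1)
      * modTheta (c * z * t ^ (4 * (n : ℤ))) p)
    * progProd f t (k + 1) (c * t ^ (2 * (n : ℤ))) * centredProd f t (n - k) t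

/-- The factor `θ(1)` vanishes. To have it, `leftPart` writes the binomial of level `n` through that
of level `n + 1`; by truncated subtraction, `thetaBinom q p n (n + 1)` need not be zero. -/
lemma leftPart_self (f : ℂ → ℂ) (p t : ℂ) (n : ℕ) (c z : ℂ) :
    leftPart f p t n c z (n + 1) = 0 := by
  simp [leftPart, modTheta_one]

lemma mul_pow_pow_eq {t : ℂ} (ht : t ≠ 0) (x : ℂ) {m k : ℕ} {a b : ℤ} (h : a + m * k = b) :
    x * t ^ a * (t ^ m) ^ k = x * t ^ b := by
  rw [← h, zpow_add₀ ht, ← pow_mul]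
  rw [← mul_assoc, ← Nat.cast_mul, zpow_natCast]

lemma expansionTerm_zero {f : ℂ → ℂ} {p t : ℂ} (ht : t ≠ 0) {n : ℕ} {c z : ℂ}
    (hc : ∀ m : ℤ, modTheta (c * t ^ m) p ≠ 0)
    (h₁ : thetaFactorial (c * z) (t ^ 4) p (n + 1) ≠ 0)
    (h₃ : thetaFactorial (t ^ 4) (t ^ 4) p (n + 1) ≠ 0) :
    expansionTerm f p t (n + 1) c z 0 = leftPart f p t n c z 0 := by
  have e1 := modTheta_ne_zero_of_lt (Nat.lt_succ_self n) h₃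
  have e2 := modTheta_ne_zero_of_lt (Nat.lt_succ_self n) h₁
  rw [← pow_succ'] at e1
  have e3 : (t ^ 4) ^ n = t ^ (4 * (n : ℤ)) := by
    rw [← pow_mul, ← zpow_natCast]; push_cast; rfl
  rw [e3] at e2
  have e4 := hc (-3)
  have e5 : thetaFactorial (c * t ^ (-1 : ℤ)) (t ^ 2) p (2 * n + 2) ≠ 0 :=
    Finset.prod_ne_zero_iff.2 fun j _ => by
      rw [mul_pow_pow_eq ht c rfl]; exact hc _
  simp only [expansionTerm, leftPart, thetaFactorial_zero, Nat.cast_zero, mul_zero, zero_sub]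
  rw [show 2 * (n + 1) + 1 = 2 * n + 2 + 1 by ring, thetaFactorial_succ',
    show c * t ^ (-3 : ℤ) * t ^ 2 = c * t ^ (-1 : ℤ) by
      simpa using mul_pow_pow_eq ht c (m := 2) (k := 1) (a := -3) (b := -1) (by norm_num)]
  simp only [progProd, Finset.range_zero, Finset.prod_empty, Nat.sub_zero, add_zero]
  generalize modTheta (c * t ^ (-3 : ℤ)) p = g at *
  generalize thetaFactorial (c * t ^ (-1 : ℤ)) (t ^ 2) p (2 * n + 2) = G at *
  field_simp

lemma modTheta_inv' {p : ℂ} (hp : ‖p‖ < 1) {x y : ℂ} (hy : y ≠ 0) (h : x = y⁻¹) :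
    modTheta x p = -x * modTheta y p := by
  rw [h, modTheta_inv hp hy]

/-- The algebra of `expansionTerm_succ` with theta values as letters. `h₁` and `h₂` remove the first
and the last factor of the denominator, and `W` is the addition formula. -/
lemma succ_aux {t z A E E' B B' g₃ G G₁ G₂ gk gl P R D X Y u v w q₁ qk qn m m' m₀ h T Q : ℂ}
    (hG : G ≠ 0) (h₁ : G = gk * G₁) (h₂ : G = G₂ * gl) (hqn : qn ≠ 0)
    (hm : m₀ ≠ 0) (hE : E' * T = E * t * Q) (hB : B * qk = B' * qn)
    (W : Q * q₁ * gk * w * m + qk * gl * h * m' = qn * g₃ * u * m₀) :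
    A * E * B * g₃ / G * (P * u * (-(t / z) * v * R)) / D * X * Y
      = A * E' * (B * q₁ / qn) / G₁ * (v * P * (R * (-(T / z) * w))) * m / (D * m₀) * X * Y
        + A * (E * t) * -z⁻¹ * B' / G₂ * (v * P * R) * h * m' / (D * m₀) * X * Y := by
  have e₁ : G₁⁻¹ = gk * G⁻¹ := by
    have := left_ne_zero_of_mul (h₁ ▸ hG)
    have := right_ne_zero_of_mul (h₁ ▸ hG)
    rw [h₁]; field_simp
  have e₂ : G₂⁻¹ = gl * G⁻¹ := by
    have := left_ne_zero_of_mul (h₂ ▸ hG)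
    have := right_ne_zero_of_mul (h₂ ▸ hG)
    rw [h₂]; field_simp
  have e₃ : B' = B * qk / qn := by field_simp; exact hB.symm
  have e₄ : g₃ * u = (Q * q₁ * gk * w * m + qk * gl * h * m') / (qn * m₀) := by
    field_simp; linear_combination -W
  simp only [div_eq_mul_inv, mul_inv] at e₃ e₄ ⊢
  rw [e₁, e₂, e₃]
  linear_combination (-(A * E * B * G⁻¹ * P * t * z⁻¹ * v * R * D⁻¹ * X * Y)) * e₄
    + A * B * q₁ * qn⁻¹ * gk * G⁻¹ * v * P * R * z⁻¹ * w * m * D⁻¹ * m₀⁻¹ * X * Y * hE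

/-- Once the common factors are removed, this is `modTheta_quadratic_addition` with `N = n`, `K = k
+ 1`. -/
lemma expansionTerm_succ {f : ℂ → ℂ} {p t : ℂ} (hp : ‖p‖ < 1) (ht : t ≠ 0) {n k : ℕ} {c z : ℂ}
    (hz : z ≠ 0) (hc0 : c ≠ 0) (hkn : k ≤ n)
    (hc : ∀ m : ℤ, modTheta (c * t ^ m) p ≠ 0)
    (h₁ : thetaFactorial (c * z) (t ^ 4) p (n + 1) ≠ 0)
    (h₂ : thetaFactorial (c / z) (t ^ 4) p (n + 1) ≠ 0)
    (h₃ : thetaFactorial (t ^ 4) (t ^ 4) p (n + 1) ≠ 0) :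
    expansionTerm f p t (n + 1) c z (k + 1)
      = leftPart f p t n c z (k + 1) + rightPart f p t n c z k := by
  have hq : ∀ m : ℕ, (t ^ 4) ^ m = t ^ (4 * (m : ℤ)) := fun m => by
    rw [← pow_mul, ← zpow_natCast]; push_cast; rfl
  have a1 := modTheta_ne_zero_of_lt (Nat.lt_succ_self n) h₃
  have a2 := modTheta_ne_zero_of_lt (Nat.lt_succ_self n) h₁
  rw [hq] at a2
  rw [← pow_succ', hq, Nat.cast_succ] at a1
  have a3 := thetaFactorial_ne_zero_of_le (Nat.succ_le_succ hkn) h₁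
  have a4 := thetaFactorial_ne_zero_of_le (Nat.succ_le_succ hkn) h₂
  have hG : ∀ (a : ℤ) l, thetaFactorial (c * t ^ a) (t ^ 2) p l ≠ 0 := fun a l =>
    Finset.prod_ne_zero_iff.2 fun j _ => by
      rw [mul_pow_pow_eq ht c rfl]; exact hc _
  have W := modTheta_quadratic_addition hp hc0 hz ht n (k + 1)
  have b1 := thetaBinom_succ_succ_mul hkn h₃
  rw [hq, hq, Nat.cast_succ, Nat.cast_succ] at b1
  -- the two factorizations of the very-well-poised denominator
  have g1 : thetaFactorial (c * t ^ (2 * ((k + 1 : ℕ) : ℤ) - 3)) (t ^ 2) p (2 * (n + 1) + 1)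
      = modTheta (c * t ^ (2 * ((k : ℤ) + 1) - 3)) p
        * thetaFactorial (c * t ^ (2 * ((k + 1 : ℕ) : ℤ) - 1)) (t ^ 2) p (2 * n + 2) := by
    rw [show 2 * (n + 1) + 1 = 2 * n + 2 + 1 by ring, thetaFactorial_succ', Nat.cast_succ]
    congr 2
    simpa using mul_pow_pow_eq ht c (m := 2) (k := 1) (a := 2 * ((k : ℤ) + 1) - 3)
      (b := 2 * ((k : ℤ) + 1) - 1) (by push_cast; ring)
  have g2 : thetaFactorial (c * t ^ (2 * ((k + 1 : ℕ) : ℤ) - 3)) (t ^ 2) p (2 * (n + 1) + 1)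
      = thetaFactorial (c * t ^ (2 * (k : ℤ) - 1)) (t ^ 2) p (2 * n + 2)
        * modTheta (c * t ^ (4 * (n : ℤ) + 2 * (k + 1) + 1)) p := by
    rw [show 2 * (n + 1) + 1 = 2 * n + 2 + 1 by ring, thetaFactorial_succ,
      mul_pow_pow_eq ht c (b := 4 * (n : ℤ) + 2 * (k + 1) + 1) (by push_cast; ring),
      show 2 * ((k + 1 : ℕ) : ℤ) - 3 = 2 * (k : ℤ) - 1 by push_cast; ring]
  have n0 := hG (2 * ((k + 1 : ℕ) : ℤ) - 3) (2 * (n + 1) + 1)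
  -- factorials in `z`
  have s1 : thetaFactorial (z / t) (t ^ 2) p (k + 1)
      = modTheta (z / t) p * thetaFactorial (t * z) (t ^ 2) p k := by
    rw [thetaFactorial_succ']; congr 2; field_simp
  have s2 : thetaFactorial (t * z) (t ^ 2) p (k + 1)
      = thetaFactorial (t * z) (t ^ 2) p k * modTheta (z * t ^ (2 * ((k : ℤ) + 1) - 1)) p := by
    have := mul_pow_pow_eq ht z (m := 2) (k := k) (a := 1) (b := 2 * ((k : ℤ) + 1) - 1)
      (by push_cast; ring)
    rw [zpow_one, mul_comm z t] at this
    rw [thetaFactorial_succ, this]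
  have s3 : thetaFactorial (t / z) (t ^ 2) p (k + 1)
      = -(t / z) * modTheta (z / t) p * thetaFactorial (t ^ 3 / z) (t ^ 2) p k := by
    rw [thetaFactorial_succ', modTheta_inv' hp (div_ne_zero hz ht) (inv_div z t).symm]
    congr 2; ring
  have s4 : thetaFactorial (t ^ 3 / z) (t ^ 2) p (k + 1)
      = thetaFactorial (t ^ 3 / z) (t ^ 2) p k
        * (-(t ^ (2 * (k : ℤ) + 3) / z) * modTheta (z * t ^ (-1 - 2 * ((k : ℤ) + 1))) p) := by
    have := mul_pow_pow_eq ht z⁻¹ (m := 2) (k := k) (a := 3) (b := 2 * (k : ℤ) + 3)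
      (by push_cast; ring)
    have e : t ^ 3 / z * (t ^ 2) ^ k = t ^ (2 * (k : ℤ) + 3) / z := by
      rw [div_eq_inv_mul, div_eq_inv_mul, ← this]; norm_cast
    rw [thetaFactorial_succ, e, modTheta_inv' hp (mul_ne_zero hz (zpow_ne_zero _ ht))]
    rw [mul_inv, ← zpow_neg, div_eq_inv_mul]; congr 2; ring
  have p1 : t ^ (3 * ((k + 1 : ℕ) : ℤ) ^ 2 - 2 * (k + 1 : ℕ)) * t ^ (2 * (k : ℤ) + 3)
      = t ^ (3 * ((k + 1 : ℕ) : ℤ) ^ 2 - 4 * (k + 1 : ℕ)) * t * t ^ (4 * ((k : ℤ) + 1)) := by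
    rw [← zpow_add₀ ht, ← zpow_add_one₀ ht, ← zpow_add₀ ht]; congr 1; push_cast; ring
  have p2 : t ^ (3 * (k : ℤ) ^ 2 + 2 * k)
      = t ^ (3 * ((k + 1 : ℕ) : ℤ) ^ 2 - 4 * (k + 1 : ℕ)) * t := by
    rw [← zpow_add_one₀ ht]; congr 1; push_cast; ring
  have c1 : 4 * ((n - k : ℕ) : ℤ) = 4 * (n + 1 - (k + 1)) := by
    push_cast [Nat.cast_sub hkn]; ring
  have c2 : 4 * (k : ℤ) = 4 * ((k : ℤ) + 1) - 4 := by ring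
  have c3 : 4 * (n : ℤ) - 2 * k + 1 = 4 * n - 2 * (k + 1) + 3 := by ring
  have c4 : 2 * (((n + 1 : ℕ) : ℤ) - 1) = 2 * n := by push_cast; ring
  have c5 : (((k + 1 : ℕ) : ℤ)) = k + 1 := by push_cast; ring
  have c6 : (((n + 1 : ℕ) : ℤ)) = n + 1 := by push_cast; ring
  rw [expansionTerm, leftPart, rightPart, s1, s2, s3, s4, p2, hq, hq, Nat.add_sub_add_right, c1, c2,
    c3, c4, c6]
  rw [c5] at *
  exact succ_aux n0 g1 g2 a1 a2 p1 b1 W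

/-- The algebra of `expansionTerm_mul_div`: `K` is the three-term relation, and `h₂` equates two
factorizations of `(c/z; q, p)_(k+1)`. -/
lemma split_aux {fw fx fy A S E B g₃ G gl P R D d D₂ D₂' X Y α₁ α₂ β β₁ m₀ θ₀ c z U B' E' E'' : ℂ}
    (hgl : gl ≠ 0) (hd : d ≠ 0) (hα : α₂ ≠ 0) (hD : D₂ ≠ 0) (h₂ : D₂ * α₂ = θ₀ * D₂')
    (hB : B' = B) (hE' : E' = S * E) (hE'' : E'' = S * E * U)
    (K : fw * gl * g₃ = fx * (c / z * U) * β₁ * β + fy * α₁ * α₂) :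
    A * S * E * B * g₃ / G * (P * R) / (D * D₂') * X * Y * fw / (m₀ * θ₀)
      = A * E' * B' / (G * gl) * (P * R) * α₁ / (D * D₂ * m₀) * X * (Y * fy)
        + A * -c * E'' * -z⁻¹ * B / (G * gl) * (P * β * R) * β₁ * d
          / (D * d * (D₂ * α₂) * m₀) * (X * fx) * Y := by
  have hD' : D₂' ≠ 0 := by
    rintro rfl
    exact mul_ne_zero hD hα (by rw [h₂, mul_zero])
  have e₁ : D₂'⁻¹ * θ₀⁻¹ = D₂⁻¹ * α₂⁻¹ := by
    rw [← mul_inv, ← mul_inv, h₂, mul_comm D₂']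
  have e₂ : fw * g₃ = (fx * (c / z * U) * β₁ * β + fy * α₁ * α₂) / gl := by
    field_simp; linear_combination K
  have e₃ : d * d⁻¹ = 1 := mul_inv_cancel₀ hd
  have e₄ : α₂ * α₂⁻¹ = 1 := mul_inv_cancel₀ hα
  subst hB hE' hE''
  simp only [div_eq_mul_inv, mul_inv] at e₂ ⊢
  linear_combination (A * S * E * B' * g₃ * G⁻¹ * P * R * D⁻¹ * X * Y * fw * m₀⁻¹) * e₁
    + (A * S * E * B' * G⁻¹ * P * R * D⁻¹ * X * Y * m₀⁻¹ * D₂⁻¹ * α₂⁻¹) * e₂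
    + A * S * E * B' * G⁻¹ * P * R * D⁻¹ * X * Y * m₀⁻¹ * D₂⁻¹ * fy * α₁ * gl⁻¹ * e₄
    - A * S * E * U * c * z⁻¹ * B' * G⁻¹ * P * R * D⁻¹ * X * Y * m₀⁻¹ * D₂⁻¹ * α₂⁻¹ * gl⁻¹
      * β * β₁ * fx * e₃

/-- Three-term relation at `w = z t^(2n)`, `x = c t^(2n+4k)`, `y = t^(1+2n-2k)`. The nodes are
chosen so that `f x` is the next factor of `progProd` and `f y` the next factor of the central
product. -/
lemma expansionTerm_mul_div {f : ℂ → ℂ} {p t : ℂ} (hp : ‖p‖ < 1) (hf : IsThetaTwo p f)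
    (ht : t ≠ 0) {n k : ℕ} {c z : ℂ} (hz : z ≠ 0) (hc0 : c ≠ 0) (hkn : k ≤ n)
    (hc : ∀ m : ℤ, modTheta (c * t ^ m) p ≠ 0)
    (h₁ : thetaFactorial (c * z) (t ^ 4) p (n + 1) ≠ 0)
    (h₂ : thetaFactorial (c / z) (t ^ 4) p (n + 1) ≠ 0)
    (h₃ : thetaFactorial (t ^ 4) (t ^ 4) p (n + 1) ≠ 0) :
    expansionTerm f p t n (c * t ^ 2) (z * t ^ (-2 : ℤ)) k * f (z * t ^ (2 * (n : ℤ)))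
        / (modTheta (c * z * t ^ (4 * (n : ℤ))) p * modTheta (c / z) p)
      = leftPart f p t n c z k + rightPart f p t n c z k := by
  have hq : ∀ m : ℕ, (t ^ 4) ^ m = t ^ (4 * (m : ℤ)) := fun m => by
    rw [← pow_mul, ← zpow_natCast]; push_cast; rfl
  have hw : z * t ^ (2 * (n : ℤ)) ≠ 0 := mul_ne_zero hz (zpow_ne_zero _ ht)
  have hx : c * t ^ (2 * (n : ℤ) + 4 * k) ≠ 0 := mul_ne_zero hc0 (zpow_ne_zero _ ht)
  have hy : t ^ (1 + 2 * (n : ℤ) - 2 * k) ≠ 0 := zpow_ne_zero _ ht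
  have K : f (z * t ^ (2 * (n : ℤ))) * modTheta (c * t ^ (4 * (n : ℤ) + 2 * k + 1)) p
        * modTheta (c * t ^ (6 * (k : ℤ) - 1)) p
      = f (c * t ^ (2 * (n : ℤ) + 4 * k)) * (c / z * t ^ (4 * (k : ℤ)))
          * modTheta (z * t ^ (4 * (n : ℤ) - 2 * k + 1)) p * modTheta (z * t ^ (2 * (k : ℤ) - 1)) p
        + f (t ^ (1 + 2 * (n : ℤ) - 2 * k)) * modTheta (c * z * t ^ (4 * (n : ℤ) + 4 * k)) p
          * modTheta (c / z * t ^ (4 * (k : ℤ))) p := by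
    have key := hf.three_term hp hw hx hy
    have u1 : c * t ^ (2 * (n : ℤ) + 4 * k) * t ^ (1 + 2 * (n : ℤ) - 2 * k)
        = c * t ^ (4 * (n : ℤ) + 2 * k + 1) := by
      rw [mul_assoc, ← zpow_add₀ ht]; congr 2; ring
    have u2 : t ^ (1 + 2 * (n : ℤ) - 2 * k) / (c * t ^ (2 * (n : ℤ) + 4 * k))
        = (c * t ^ (6 * (k : ℤ) - 1))⁻¹ := by
      rw [div_eq_iff hx, eq_inv_mul_iff_mul_eq₀ (mul_ne_zero hc0 (zpow_ne_zero _ ht)), mul_assoc,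
        ← zpow_add₀ ht]
      congr 2; ring
    have u3 : t ^ (1 + 2 * (n : ℤ) - 2 * k) * (z * t ^ (2 * (n : ℤ)))
        = z * t ^ (4 * (n : ℤ) - 2 * k + 1) := by
      rw [mul_left_comm, ← zpow_add₀ ht]; congr 2; ring
    have u4 : t ^ (1 + 2 * (n : ℤ) - 2 * k) / (z * t ^ (2 * (n : ℤ)))
        = (z * t ^ (2 * (k : ℤ) - 1))⁻¹ := by
      rw [div_eq_iff hw, eq_inv_mul_iff_mul_eq₀ (mul_ne_zero hz (zpow_ne_zero _ ht)), mul_assoc,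
        ← zpow_add₀ ht]
      congr 2; ring
    have u5 : c * t ^ (2 * (n : ℤ) + 4 * k) * (z * t ^ (2 * (n : ℤ)))
        = c * z * t ^ (4 * (n : ℤ) + 4 * k) := by
      rw [mul_mul_mul_comm, ← zpow_add₀ ht]; congr 2; ring
    have u6 : c * t ^ (2 * (n : ℤ) + 4 * k) / (z * t ^ (2 * (n : ℤ))) = c / z * t ^ (4 * (k : ℤ)) := by
      rw [mul_div_mul_comm, ← zpow_sub₀ ht]; congr 2; ring
    rw [modTheta_inv' hp (mul_ne_zero hc0 (zpow_ne_zero _ ht)) u2,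
      modTheta_inv' hp (mul_ne_zero hz (zpow_ne_zero _ ht)) u4, u1, u3, u5] at key
    rw [← u6]
    generalize c * t ^ (2 * (n : ℤ) + 4 * k) = x at *
    generalize t ^ (1 + 2 * (n : ℤ) - 2 * k) = y at *
    generalize z * t ^ (2 * (n : ℤ)) = w at *
    field_simp at key ⊢
    linear_combination -key
  have hk1 : thetaFactorial (c / z) (t ^ 4) p (k + 1) ≠ 0 :=
    thetaFactorial_ne_zero_of_le (Nat.succ_le_succ hkn) h₂
  have a1 := modTheta_ne_zero_of_lt (Nat.lt_succ_self n) h₃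
  rw [← pow_succ'] at a1
  have a2 := modTheta_ne_zero_of_lt (Nat.lt_succ_of_le hkn) h₁
  have a3 := modTheta_ne_zero_of_lt (Nat.lt_succ_of_le hkn) h₂
  rw [hq] at a2 a3
  have v1 : ∀ {a b : ℤ}, a + 2 = b → c * t ^ 2 * t ^ a = c * t ^ b := by
    rintro a b rfl
    rw [mul_assoc, ← zpow_natCast t 2, ← zpow_add₀ ht]; congr 2; push_cast; ring
  have v2 : t * (z * t ^ (-2 : ℤ)) = z / t := by
    rw [zpow_neg]; norm_cast; field_simp
  have v3 : t / (z * t ^ (-2 : ℤ)) = t ^ 3 / z := by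
    rw [zpow_neg]; norm_cast; field_simp
  have v4 : c * t ^ 2 * (z * t ^ (-2 : ℤ)) = c * z := by
    rw [zpow_neg]; norm_cast; field_simp
  have v5 : c * t ^ 2 / (z * t ^ (-2 : ℤ)) = c / z * t ^ 4 := by
    rw [zpow_neg]; norm_cast; field_simp
  have w1 : thetaFactorial (c * t ^ (2 * (k : ℤ) - 1)) (t ^ 2) p (2 * n + 2)
      = thetaFactorial (c * t ^ (2 * (k : ℤ) - 1)) (t ^ 2) p (2 * n + 1)
        * modTheta (c * t ^ (4 * (n : ℤ) + 2 * k + 1)) p := by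
    rw [thetaFactorial_succ, mul_pow_pow_eq ht c (b := 4 * (n : ℤ) + 2 * k + 1) (by push_cast; ring)]
  have w2 : centredProd f t (n + 1 - k) t
      = centredProd f t (n - k) t * f (t ^ (1 + 2 * (n : ℤ) - 2 * k)) := by
    rw [Nat.sub_add_comm hkn, centredProd_self_succ hf ht]
    congr 3; push_cast [Nat.cast_sub hkn]; ring
  have w3 : progProd f t (k + 1) (c * t ^ (2 * (n : ℤ)))
      = progProd f t k (c * t ^ (2 * (n : ℤ))) * f (c * t ^ (2 * (n : ℤ) + 4 * k)) := by
    rw [progProd_succ, mul_assoc c, ← zpow_add₀ ht]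
  have w4 : thetaFactorial (z / t) (t ^ 2) p (k + 1)
      = thetaFactorial (z / t) (t ^ 2) p k * modTheta (z * t ^ (2 * (k : ℤ) - 1)) p := by
    rw [thetaFactorial_succ, ← mul_pow_pow_eq ht z (m := 2) (k := k) (a := -1) (by push_cast; ring),
      zpow_neg_one, div_eq_mul_inv]
  have w5 : ∀ x : ℂ, thetaFactorial x (t ^ 4) p (k + 1)
      = thetaFactorial x (t ^ 4) p k * modTheta (x * t ^ (4 * (k : ℤ))) p := fun x => by
    rw [thetaFactorial_succ, hq]
  have w6 : (-(c * t ^ 2)) ^ k = (-c) ^ k * t ^ (2 * (k : ℤ)) := by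
    rw [← neg_mul, mul_pow, ← pow_mul, ← zpow_natCast t]; push_cast; rfl
  rw [expansionTerm, leftPart, rightPart, v1 (b := 6 * (k : ℤ) - 1) (by ring),
    v1 (b := 2 * (k : ℤ) - 1) (by ring), v1 (b := 2 * (n : ℤ)) (by ring), v2, v3, v4, v5, w1, w2,
    w3, w4, w5, w5, w6, pow_succ (-c)]
  rw [w5] at hk1
  refine split_aux (hc _) a2 a3 (left_ne_zero_of_mul hk1) ?_ ?_ ?_ ?_ K
  · rw [← w5, thetaFactorial_succ']
  · rw [thetaBinom_succ_mul hkn h₃, mul_div_assoc, div_self a1, mul_one]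
  · rw [← zpow_add₀ ht]; congr 1; ring
  · rw [← zpow_add₀ ht, ← zpow_add₀ ht]; congr 1; ring

/-- The expansion of `centredProd f t n z / (c z, c / z; q, p)_n` for generic `c`. -/
theorem centredProd_div_eq_sum {f : ℂ → ℂ} {p t : ℂ} (hp : ‖p‖ < 1) (hf : IsThetaTwo p f)
    (ht : t ≠ 0) (n : ℕ) {c z : ℂ} (hc0 : c ≠ 0) (hz : z ≠ 0)
    (hc : ∀ m : ℤ, modTheta (c * t ^ m) p ≠ 0)
    (h₁ : thetaFactorial (c * z) (t ^ 4) p n ≠ 0)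
    (h₂ : thetaFactorial (c / z) (t ^ 4) p n ≠ 0)
    (h₃ : thetaFactorial (t ^ 4) (t ^ 4) p n ≠ 0) :
    centredProd f t n z / (thetaFactorial (c * z) (t ^ 4) p n * thetaFactorial (c / z) (t ^ 4) p n)
      = ∑ k ∈ Finset.range (n + 1), expansionTerm f p t n c z k := by
  induction n generalizing c z with
  | zero =>
    have h := hc (-3)
    simp [centredProd, expansionTerm, thetaFactorial_zero, thetaFactorial_succ, thetaBinom,
      progProd] at h ⊢
    rw [div_self h]
  | succ n ih =>
    -- The shift `(c, z) ↦ (c t², z t⁻²)` preserves `c z` and multiplies `c / z` by `q`, so the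
    -- shifted factorials are sub-products of those at level `n + 1`.
    have v4 : c * t ^ 2 * (z * t ^ (-2 : ℤ)) = c * z := by
      rw [zpow_neg]; norm_cast; field_simp
    have v5 : c * t ^ 2 / (z * t ^ (-2 : ℤ)) = c / z * t ^ 4 := by
      rw [zpow_neg]; norm_cast; field_simp
    have h₂' := h₂
    rw [thetaFactorial_succ'] at h₂'
    have IH := ih (mul_ne_zero hc0 (pow_ne_zero 2 ht)) (mul_ne_zero hz (zpow_ne_zero (-2) ht))
      (fun m => by
        rw [mul_assoc, ← zpow_natCast t 2, ← zpow_add₀ ht]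
        exact hc _)
      (by rw [v4]; exact thetaFactorial_ne_zero_of_le n.le_succ h₁)
      (by rw [v5]; exact right_ne_zero_of_mul h₂') (thetaFactorial_ne_zero_of_le n.le_succ h₃)
    rw [v4, v5] at IH
    have hq : (t ^ 4) ^ n = t ^ (4 * (n : ℤ)) := by
      rw [← pow_mul, ← zpow_natCast]; push_cast; rfl
    calc
      _ = (∑ k ∈ Finset.range (n + 1), expansionTerm f p t n (c * t ^ 2) (z * t ^ (-2 : ℤ)) k)
          * f (z * t ^ (2 * (n : ℤ)))
          / (modTheta (c * z * t ^ (4 * (n : ℤ))) p * modTheta (c / z) p) := by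
        rw [← IH, centredProd_succ f ht, thetaFactorial_succ (c * z), thetaFactorial_succ' (c / z),
          hq]
        simp only [div_eq_mul_inv, mul_inv]
        ring
      _ = ∑ k ∈ Finset.range (n + 1), (leftPart f p t n c z k + rightPart f p t n c z k) := by
        rw [Finset.sum_mul, Finset.sum_div]
        exact Finset.sum_congr rfl fun k hk => expansionTerm_mul_div hp hf ht hz hc0
          (Nat.lt_succ_iff.1 (Finset.mem_range.1 hk)) hc h₁ h₂ h₃
      _ = _ := by
        -- Term `0` consists of a left part only, and the left part of index `n + 1` is zero, so the
        -- two sums have the same pieces.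
        rw [Finset.sum_range_succ' (expansionTerm f p t (n + 1) c z), expansionTerm_zero ht hc h₁ h₃,
          Finset.sum_congr rfl fun k hk => expansionTerm_succ hp ht hz hc0
            (Nat.lt_succ_iff.1 (Finset.mem_range.1 hk)) hc h₁ h₂ h₃,
          Finset.sum_add_distrib, Finset.sum_add_distrib, add_right_comm,
          ← Finset.sum_range_succ', Finset.sum_range_succ (leftPart f p t n c z) (n + 1),
          leftPart_self, add_zero]

/-! ### From the generic to the classical form of the terms -/

lemma thetaFactorial_interlace {t : ℂ} (ht : t ≠ 0) (c p : ℂ) (n : ℕ) :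
    thetaFactorial (c * t⁻¹) (t ^ 4) p n * thetaFactorial (c * t) (t ^ 4) p n
      = thetaFactorial (c * t⁻¹) (t ^ 2) p (2 * n) := by
  induction n with
  | zero => simp [thetaFactorial_zero]
  | succ n ih =>
    have e1 : c * t⁻¹ * (t ^ 2) ^ (2 * n) = c * t⁻¹ * (t ^ 4) ^ n := by ring
    have e2 : c * t⁻¹ * (t ^ 2) ^ (2 * n + 1) = c * t * (t ^ 4) ^ n := by
      field_simp; ring
    rw [show 2 * (n + 1) = 2 * n + 1 + 1 by ring, thetaFactorial_succ, thetaFactorial_succ,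
      thetaFactorial_succ, thetaFactorial_succ, e1, e2, ← ih]
    ring

/-- Both sides come from splitting `(c q^(-1/4); q^(1/2), p)_(2n+k)`, once after `k` and once after
`2n` factors. -/
lemma thetaFactorial_mul_wellPoised {t : ℂ} (ht : t ≠ 0) (c p : ℂ) (n k : ℕ) :
    thetaFactorial (c * t⁻¹) (t ^ 2) p k
        * thetaFactorial (c * t ^ (2 * (k : ℤ) - 3)) (t ^ 2) p (2 * n + 1)
      = modTheta (c * t ^ (2 * (k : ℤ) - 3)) p * thetaFactorial (c * t⁻¹) (t ^ 2) p (2 * n)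
        * thetaFactorial (c * (t ^ 4) ^ n * t⁻¹) (t ^ 2) p k := by
  have h := thetaFactorial_add (c * t⁻¹) (t ^ 2) p (2 * n) k
  rw [add_comm, thetaFactorial_add] at h
  have e1 : c * t ^ (2 * (k : ℤ) - 3) * t ^ 2 = c * t⁻¹ * (t ^ 2) ^ k := by
    rw [← zpow_neg_one, mul_pow_pow_eq ht c rfl, mul_assoc, ← zpow_natCast t 2, ← zpow_add₀ ht]
    congr 2; push_cast; ring
  have e2 : c * (t ^ 4) ^ n * t⁻¹ = c * t⁻¹ * (t ^ 2) ^ (2 * n) := by ring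
  rw [thetaFactorial_succ', e1, e2]
  linear_combination modTheta (c * t ^ (2 * (k : ℤ) - 3)) p * h

/-- Each factor is reflected by `θ(1/x) = -θ(x)/x`; this converts the elliptic binomial into
`(q^(-n))_k / (q)_k`. -/
lemma thetaFactorial_zpow_neg {t p : ℂ} (hp : ‖p‖ < 1) (ht : t ≠ 0) {n k : ℕ} (hk : k ≤ n) :
    thetaFactorial ((t ^ 4) ^ (-(n : ℤ))) (t ^ 4) p k * t ^ (4 * (n : ℤ) * k)
        * thetaFactorial (t ^ 4) (t ^ 4) p (n - k)
      = (-1) ^ k * t ^ (2 * (k : ℤ) * (k - 1)) * thetaFactorial (t ^ 4) (t ^ 4) p n := by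
  induction k with
  | zero => simp [thetaFactorial_zero]
  | succ k ih =>
    have h := ih (by omega)
    obtain ⟨d, rfl⟩ := Nat.exists_eq_add_of_lt hk
    rw [show k + d + 1 - k = d + 1 by omega, thetaFactorial_succ _ _ _ d, ← pow_succ'] at h
    rw [show k + d + 1 - (k + 1) = d by omega, thetaFactorial_succ]
    have e1 : (t ^ 4) ^ (-((k + d + 1 : ℕ) : ℤ)) * (t ^ 4) ^ k = ((t ^ 4) ^ (d + 1))⁻¹ := by
      rw [zpow_neg, zpow_natCast, add_assoc, pow_add]; field_simp
    have e2 : t ^ (4 * ((k + d + 1 : ℕ) : ℤ) * (k + 1 : ℕ)) * ((t ^ 4) ^ (d + 1))⁻¹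
        = t ^ (4 * ((k + d + 1 : ℕ) : ℤ) * k) * t ^ (4 * (k : ℤ)) := by
      rw [← pow_mul, ← zpow_natCast, ← zpow_neg, ← zpow_add₀ ht, ← zpow_add₀ ht]
      congr 1; push_cast; ring
    have e3 : t ^ (2 * ((k + 1 : ℕ) : ℤ) * ((k + 1 : ℕ) - 1))
        = t ^ (2 * (k : ℤ) * (k - 1)) * t ^ (4 * (k : ℤ)) := by
      rw [← zpow_add₀ ht]; congr 1; push_cast; ring
    rw [e1, modTheta_inv hp (by positivity), e3]
    linear_combination (-t ^ (4 * (k : ℤ))) * h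
      - thetaFactorial ((t ^ 4) ^ (-((k + d + 1 : ℕ) : ℤ))) (t ^ 4) p k
        * modTheta ((t ^ 4) ^ (d + 1)) p * thetaFactorial (t ^ 4) (t ^ 4) p d * e2

/-- The `k`-th term of the expansion, with only the denominators that occur in its classical
form. -/
def classicalTerm (f : ℂ → ℂ) (p t : ℂ) (n : ℕ) (z c : ℂ) (k : ℕ) : ℂ :=
  c ^ k * t ^ ((k : ℤ) * ((k : ℤ) - 2)) * (t ^ 4) ^ (n * k)
    * (modTheta (c * t ^ (6 * (k : ℤ) - 3)) p / modTheta (c * t ^ (2 * (k : ℤ) - 3)) p)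
    * (thetaFactorial ((t ^ 4) ^ (-(n : ℤ))) (t ^ 4) p k / thetaFactorial (t ^ 4) (t ^ 4) p k)
    * (thetaFactorial (c * t⁻¹) (t ^ 2) p k
        / thetaFactorial (c * (t ^ 4) ^ n * t⁻¹) (t ^ 2) p k)
    * (thetaFactorial (t * z) (t ^ 2) p k * thetaFactorial (t / z) (t ^ 2) p k
        / (thetaFactorial (c * z) (t ^ 4) p k * thetaFactorial (c / z) (t ^ 4) p k))
    * progProd f t k (c * t ^ (2 * ((n : ℤ) - 1))) * centredProd f t (n - k) t

lemma expansionTerm_mul_eq_classicalTerm (f : ℂ → ℂ) {p t : ℂ} (hp : ‖p‖ < 1) (ht : t ≠ 0)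
    {n k : ℕ} (hk : k ≤ n) {c z : ℂ} (hc : ∀ m : ℤ, modTheta (c * t ^ m) p ≠ 0)
    (h₃ : thetaFactorial (t ^ 4) (t ^ 4) p n ≠ 0) :
    expansionTerm f p t n c z k
        * (thetaFactorial (c * t⁻¹) (t ^ 4) p n * thetaFactorial (c * t) (t ^ 4) p n)
      = classicalTerm f p t n z c k := by
  have hG : ∀ (a : ℤ) l, thetaFactorial (c * t ^ a) (t ^ 2) p l ≠ 0 := fun a l =>
    Finset.prod_ne_zero_iff.2 fun j _ => by
      rw [mul_pow_pow_eq ht c rfl]; exact hc _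
  have e2 : c * (t ^ 4) ^ n * t⁻¹ = c * t ^ (4 * (n : ℤ) - 1) := by
    rw [zpow_sub_one₀ ht, zpow_mul]; norm_cast; ring
  have n1 := hG (4 * (n : ℤ) - 1) k
  have n2 := hG (2 * (k : ℤ) - 3) (2 * n + 1)
  have n3 := hc (2 * (k : ℤ) - 3)
  have n4 := thetaFactorial_ne_zero_of_le hk h₃
  have n5 := thetaFactorial_ne_zero_of_le (Nat.sub_le n k) h₃
  have h1 := thetaFactorial_mul_wellPoised ht c p n k
  have h2 := thetaFactorial_zpow_neg hp ht hk
  rw [e2] at h1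
  have h1' : thetaFactorial (c * t⁻¹) (t ^ 2) p (2 * n)
        / thetaFactorial (c * t ^ (2 * (k : ℤ) - 3)) (t ^ 2) p (2 * n + 1)
      = thetaFactorial (c * t⁻¹) (t ^ 2) p k / thetaFactorial (c * t ^ (4 * (n : ℤ) - 1)) (t ^ 2) p k
        / modTheta (c * t ^ (2 * (k : ℤ) - 3)) p := by
    rw [div_div, div_eq_div_iff n2 (mul_ne_zero n1 n3)]
    linear_combination -h1
  have h2' : t ^ (2 * (k : ℤ) * (k - 1)) * (-1) ^ k * thetaBinom (t ^ 4) p n k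
      = t ^ (4 * (n : ℤ) * k) * (thetaFactorial ((t ^ 4) ^ (-(n : ℤ))) (t ^ 4) p k
        / thetaFactorial (t ^ 4) (t ^ 4) p k) := by
    rw [thetaBinom, mul_div_assoc', mul_div_assoc', div_eq_div_iff (mul_ne_zero n4 n5) n4]
    linear_combination -thetaFactorial (t ^ 4) (t ^ 4) p k * h2
  have e3 : (t ^ 4) ^ (n * k) = t ^ (4 * (n : ℤ) * k) := by
    rw [← pow_mul, ← zpow_natCast]; congr 1; push_cast; ring
  have e4 : t ^ (3 * (k : ℤ) ^ 2 - 4 * k) = t ^ ((k : ℤ) * ((k : ℤ) - 2)) * t ^ (2 * (k : ℤ) * (k - 1)) := by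
    rw [← zpow_add₀ ht]; congr 1; ring
  rw [thetaFactorial_interlace ht, expansionTerm, classicalTerm, e2, e3, e4, neg_pow]
  simp only [div_eq_mul_inv] at h1' h2' ⊢
  generalize thetaFactorial (c * t⁻¹) (t ^ 2) p (2 * n) = A at *
  generalize (thetaFactorial (c * t ^ (2 * (k : ℤ) - 3)) (t ^ 2) p (2 * n + 1))⁻¹ = B at *
  generalize thetaFactorial (c * z) (t ^ 4) p k * thetaFactorial (c * z⁻¹) (t ^ 4) p k = D at *
  generalize thetaFactorial (t * z) (t ^ 2) p k * thetaFactorial (t * z⁻¹) (t ^ 2) p k = E at *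
  generalize progProd f t k (c * t ^ (2 * ((n : ℤ) - 1))) = X at *
  generalize centredProd f t (n - k) t = Y at *
  generalize t ^ ((k : ℤ) * ((k : ℤ) - 2)) = F at *
  generalize modTheta (c * t ^ (6 * (k : ℤ) - 3)) p = G at *
  linear_combination c ^ k * F * G * E * D⁻¹ * X * Y * (A * B * h2'
    + t ^ (4 * (n : ℤ) * k) * (thetaFactorial ((t ^ 4) ^ (-(n : ℤ))) (t ^ 4) p k
        * (thetaFactorial (t ^ 4) (t ^ 4) p k)⁻¹) * h1')

/-! ### Removal of genericity by continuity in `c` -/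

section Continuity

variable {p : ℂ} {g : ℂ → ℂ} {c : ℂ}

lemma ContinuousAt.modTheta (hg : ContinuousAt g c) (hp : ‖p‖ < 1) (h0 : g c ≠ 0) :
    ContinuousAt (fun x => modTheta (g x) p) c :=
  ContinuousAt.comp (g := fun y => _root_.modTheta y p) (continuousAt_modTheta hp h0) hg

lemma ContinuousAt.thetaFactorial (hg : ContinuousAt g c) (hp : ‖p‖ < 1) (h0 : g c ≠ 0) {q : ℂ}
    (hq : q ≠ 0) (n : ℕ) : ContinuousAt (fun x => thetaFactorial (g x) q p n) c :=
  tendsto_finsetProd _ fun i _ =>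
    (hg.mul continuousAt_const).modTheta hp (mul_ne_zero h0 (pow_ne_zero i hq))

lemma ContinuousAt.progProd {f : ℂ → ℂ} (hf : IsThetaTwo p f) (hg : ContinuousAt g c)
    (hp : ‖p‖ < 1) (h0 : g c ≠ 0) {t : ℂ} (ht : t ≠ 0) (k : ℕ) :
    ContinuousAt (fun x => progProd f t k (g x)) c :=
  tendsto_finsetProd _ fun i _ =>
    ContinuousAt.comp (g := f) (f := fun x => g x * t ^ (4 * (i : ℤ)))
      (hf.continuousAt hp (mul_ne_zero h0 (zpow_ne_zero _ ht))) (hg.mul continuousAt_const)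

end Continuity

/-- The quadratic expansion of a centred product of symmetric theta functions of degree two. -/
theorem centredProd_div_mul_eq_sum {f : ℂ → ℂ} {p t : ℂ} (hp : ‖p‖ < 1) (hf : IsThetaTwo p f)
    (ht : t ≠ 0) (n : ℕ) {c z : ℂ} (hc : c ≠ 0) (hz : z ≠ 0)
    (h₁ : thetaFactorial (c * z) (t ^ 4) p n ≠ 0)
    (h₂ : thetaFactorial (c / z) (t ^ 4) p n ≠ 0)
    (h₃ : thetaFactorial (t ^ 4) (t ^ 4) p n ≠ 0)
    (h₄ : thetaFactorial (c * (t ^ 4) ^ n * t⁻¹) (t ^ 2) p n ≠ 0)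
    (h₅ : ∀ k ≤ n, modTheta (c * t ^ (2 * (k : ℤ) - 3)) p ≠ 0) :
    centredProd f t n z / (thetaFactorial (c * z) (t ^ 4) p n * thetaFactorial (c / z) (t ^ 4) p n)
        * (thetaFactorial (c * t⁻¹) (t ^ 4) p n * thetaFactorial (c * t) (t ^ 4) p n)
      = ∑ k ∈ Finset.range (n + 1), classicalTerm f p t n z c k := by
  have h2 := pow_ne_zero 2 ht
  have h4 := pow_ne_zero 4 ht
  have hmul : ∀ {b : ℂ}, ContinuousAt (fun x : ℂ => x * b) c := by intro b; fun_prop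
  have hTF : ∀ {b q : ℂ} (k : ℕ), b ≠ 0 → q ≠ 0 →
      ContinuousAt (fun x => thetaFactorial (x * b) q p k) c := fun k hb hq =>
    hmul.thetaFactorial hp (mul_ne_zero hc hb) hq k
  have cz : ∀ k, ContinuousAt (fun x => thetaFactorial (x * z) (t ^ 4) p k) c := fun k => hTF k hz h4
  have cz' : ∀ k, ContinuousAt (fun x => thetaFactorial (x / z) (t ^ 4) p k) c := fun k => by
    simpa only [div_eq_mul_inv] using hTF k (inv_ne_zero hz) h4
  have hL : ContinuousAt (fun x => centredProd f t n z
      / (thetaFactorial (x * z) (t ^ 4) p n * thetaFactorial (x / z) (t ^ 4) p n)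
        * (thetaFactorial (x * t⁻¹) (t ^ 4) p n * thetaFactorial (x * t) (t ^ 4) p n)) c :=
    (continuousAt_const.div ((cz n).mul (cz' n)) (mul_ne_zero h₁ h₂)).mul
      ((hTF n (inv_ne_zero ht) h4).mul (hTF n ht h4))
  have hR : ContinuousAt (fun x => ∑ k ∈ Finset.range (n + 1), classicalTerm f p t n z x k) c := by
    refine tendsto_finsetSum _ fun k hk => ?_
    have hk : k ≤ n := Nat.lt_succ_iff.1 (Finset.mem_range.1 hk)
    have hth : ∀ m : ℤ, ContinuousAt (fun x => modTheta (x * t ^ m) p) c := fun m =>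
      hmul.modTheta hp (mul_ne_zero hc (zpow_ne_zero _ ht))
    have c4 : ContinuousAt (fun x => thetaFactorial (x * (t ^ 4) ^ n * t⁻¹) (t ^ 2) p k) c := by
      simpa only [mul_assoc] using hTF k (mul_ne_zero (pow_ne_zero n h4) (inv_ne_zero ht)) h2
    have cX : ContinuousAt (fun x => progProd f t k (x * t ^ (2 * ((n : ℤ) - 1)))) c :=
      ContinuousAt.progProd hf hmul hp (mul_ne_zero hc (zpow_ne_zero _ ht)) ht k
    exact (((((((((continuousAt_id.pow k).mul continuousAt_const).mul continuousAt_const).mul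
      ((hth _).div (hth _) (h₅ k hk))).mul continuousAt_const).mul
      ((hTF k (inv_ne_zero ht) h2).div c4 (thetaFactorial_ne_zero_of_le hk h₄))).mul
      (continuousAt_const.div ((cz k).mul (cz' k)) (mul_ne_zero
        (thetaFactorial_ne_zero_of_le hk h₁) (thetaFactorial_ne_zero_of_le hk h₂)))).mul cX).mul
      continuousAt_const)
  refine tendsto_nhds_unique_of_frequently_eq hL.tendsto hR.tendsto ?_
  -- The given `c` may itself be exceptional; density supplies generic points arbitrarily close to
  -- it, where equality is known.
  have hdense := (countable_modTheta_eq_zero hp ht).dense_compl ℂ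
  have hfreq := mem_closure_iff_frequently.1 (hdense c)
  refine (hfreq.and_eventually ((continuousAt_id.eventually_ne hc).and
    (((cz n).eventually_ne h₁).and ((cz' n).eventually_ne h₂)))).mono ?_
  rintro x ⟨hx, hx0, hx1, hx2⟩
  have hx : ∀ m : ℤ, modTheta (x * t ^ m) p ≠ 0 := fun m hm => hx ⟨m, hm⟩
  rw [centredProd_div_eq_sum (c := x) hp hf ht n hx0 hz hx hx1 hx2 h₃, Finset.sum_mul]
  exact Finset.sum_congr rfl fun k hk => expansionTerm_mul_eq_classicalTerm f hp ht
    (Nat.lt_succ_iff.1 (Finset.mem_range.1 hk)) hx h₃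

/-! ### Specialization to cubic theta functions -/

lemma sq_zpow {t : ℂ} (m : ℤ) : (t ^ 2) ^ m = t ^ (2 * m) := by
  rw [zpow_mul]; norm_cast

lemma cubicFactorial_eq_prod {t : ℂ} (ht : t ≠ 0) (a z r : ℂ) {n : ℕ} {a' : ℂ}
    (ha : a * (t ^ 2) ^ ((n : ℤ) - 1) = a') :
    cubicFactorial a z (t ^ 2) r n = centredProd (fun x => cubicTheta a' x r) t n z := by
  refine Finset.prod_congr rfl fun j _ => ?_
  rw [ha, sq_zpow, mul_assoc, zpow_add₀ ht]
  congr 3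
  rw [← pow_mul, ← pow_mul, ← zpow_natCast]; push_cast; congr 1; ring

end

/-- Here `t = q^(1/4)`, `t ^ 2 = q^(1/2)`, `r = p^(1/3)` (any choice of the roots).
The factor `⟨⟨a c q^(n-1), a q^(1-k) / c; q, r⟩⟩_k` is
`⟨⟨A Z, A / Z; q, r⟩⟩_k` with `A = a q^((n-k)/2)`, `Z = c q^((n+k-2)/2)`, and
`⟨⟨a q^(k/2+1/4), a q^(k/2-1/4); q, r⟩⟩_(n-k)` is
`⟨⟨A Z, A / Z; q, r⟩⟩_(n-k)` with `A = a q^(k/2)`, `Z = q^(1/4)`. -/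
theorem corollary3p7 (n : ℕ) (a c z q t p r : ℂ)
    (ha : a ≠ 0) (hc : c ≠ 0) (hz : z ≠ 0) (hq : q ≠ 0)
    (ht : t ^ 4 = q) (hr : r ^ 3 = p) (hp : ‖p‖ < 1)
    -- no denominator in the identity vanishes
    (h₁ : thetaFactorial (c * z) q p n ≠ 0)
    (h₂ : thetaFactorial (c / z) q p n ≠ 0)
    (h₃ : thetaFactorial q q p n ≠ 0)
    (h₄ : thetaFactorial (c * q ^ n * t⁻¹) (t ^ 2) p n ≠ 0)
    (h₅ : ∀ k ≤ n, modTheta (c * t ^ (2 * (k : ℤ) - 3)) p ≠ 0) :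
    cubicFactorial a z (t ^ 2) r n
        / (thetaFactorial (c * z) q p n * thetaFactorial (c / z) q p n)
        * (thetaFactorial (c * t⁻¹) q p n * thetaFactorial (c * t) q p n)
      = ∑ k ∈ Finset.range (n + 1),
          c ^ k * t ^ ((k : ℤ) * ((k : ℤ) - 2)) * q ^ (n * k)
            * (modTheta (c * t ^ (6 * (k : ℤ) - 3)) p
                / modTheta (c * t ^ (2 * (k : ℤ) - 3)) p)
            * (thetaFactorial (q ^ (-(n : ℤ))) q p k / thetaFactorial q q p k)
            * (thetaFactorial (c * t⁻¹) (t ^ 2) p k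
                / thetaFactorial (c * q ^ n * t⁻¹) (t ^ 2) p k)
            * (thetaFactorial (t * z) (t ^ 2) p k * thetaFactorial (t / z) (t ^ 2) p k
                / (thetaFactorial (c * z) q p k * thetaFactorial (c / z) q p k))
            * cubicFactorial (a * (t ^ 2) ^ ((n : ℤ) - k)) (c * (t ^ 2) ^ ((n : ℤ) + k - 2))
                (t ^ 2) r k
            * cubicFactorial (a * (t ^ 2) ^ k) t (t ^ 2) r (n - k) := by
  subst ht
  have ht : t ≠ 0 := fun h => hq (by simp [h])
  have h2 := pow_ne_zero 2 ht
  -- The first argument of γ is `a q^((n-1)/2)` in every factor: on the right, `(n-k)/2 + (k-1)/2`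
  -- and `k/2 + (n-k-1)/2` both equal `(n-1)/2`.
  have key := centredProd_div_mul_eq_sum hp (isThetaTwo_cubicTheta hr hp
    (mul_ne_zero ha (zpow_ne_zero ((n : ℤ) - 1) h2))) ht n hc hz h₁ h₂ h₃ h₄ h₅
  rw [cubicFactorial_eq_prod ht a z r rfl, key]
  refine Finset.sum_congr rfl fun k hk => ?_
  have hk : k ≤ n := Nat.lt_succ_iff.1 (Finset.mem_range.1 hk)
  rw [classicalTerm]
  congr 1
  · congr 1
    rw [cubicFactorial_eq_prod ht (a' := a * (t ^ 2) ^ ((n : ℤ) - 1))]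
    · refine Finset.prod_congr rfl fun j _ => ?_
      dsimp only
      rw [sq_zpow, sq_zpow, mul_assoc, mul_assoc, ← zpow_add₀ ht, ← zpow_add₀ ht]
      congr 3; ring
    · rw [mul_assoc, ← zpow_add₀ h2]; congr 2; ring
  · rw [cubicFactorial_eq_prod ht (a' := a * (t ^ 2) ^ ((n : ℤ) - 1))]
    rw [← zpow_natCast (t ^ 2) k, mul_assoc, ← zpow_add₀ h2]
    congr 2; push_cast [Nat.cast_sub hk]; ring
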